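/- For a finite-dimensional real Lie algebra $\mathfrak g$ let $\mu(\mathfrak g)$ be the least $n$ such that $\mathfrak g$ has a faithful representation $\mathfrak g\to\mathfrak{gl}(n,\mathbb R)$. Consider the following real Lie algebras with basis $X_1,\dots,X_n$ (brackets not listed vanish, up to antisymmetry). The Levi factor is spanned by $X_1,X_2,X_3$; it is $\mathfrak{sl}(2,\mathbb R)$: $[X_1,X_2]=2X_2$, $[X_1,X_3]=-2X_3$, $[X_2,X_3]=X_1$, except for $L_{6.1},L_{7.1},L_{7.2}$, where it is $\mathfrak{so}(3)$: $[X_1,X_2]=X_3$, $[X_2,X_3]=X_1$, $[X_3,X_1]=X_2$. The radical is spanned by the remaining vectors. Abbreviate the actions * $D_{1/2}$ on $(u,v)$: $[X_1,u]=u$, $[X_1,v]=-v$, $[X_2,v]=u$, $[X_3,u]=v$; * $D_1$ on $(u,v,w)$: $[X_1,u]=2u$, $[X_1,w]=-2w$, $[X_2,v]=2u$, $[X_2,w]=v$, $[X_3,u]=v$, $[X_3,v]=2w$; * $D_{3/2}$ on $(u,v,w,z)$: $[X_1,u]=3u$, $[X_1,v]=v$, $[X_1,w]=-w$, $[X_1,z]=-3z$,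 $[X_2,v]=3u$, $[X_2,w]=2v$, $[X_2,z]=w$, $[X_3,u]=v$, $[X_3,v]=2w$, $[X_3,w]=3z$; * $R_3$ on $(u,v,w)$: $[X_1,v]=w$, $[X_1,w]=-v$, $[X_2,w]=u$, $[X_2,u]=-w$, $[X_3,u]=v$, $[X_3,v]=-u$; * $R_4$ on $(u,v,w,z)$, identified with the quaternions $1,i,j,k$: $X_1,X_2,X_3$ act as left multiplication by $\tfrac i2,\tfrac j2,\tfrac k2$. The algebras are: * $L_{5.1}$: $D_{1/2}$ on $(X_4,X_5)$, abelian radical. * $L_{6.1}$: $R_3$ on $(X_4,X_5,X_6)$, abelian radical. * $L_{6.2}$: $D_{1/2}$ on $(X_4,X_5)$; $[X_4,X_5]=X_6$. * $L_{6.3}$: $D_{1/2}$ on $(X_4,X_5)$; $[X_4,X_6]=X_4$, $[X_5,X_6]=X_5$. * $L_{6.4}$: $D_1$ on $(X_4,X_5,X_6)$, abelian radical. * $L_{7.1}$: $R_3$ on $(X_4,X_5,X_6)$; $[X_i,X_7]=X_i$ for $i=4,5,6$. * $L_{7.2}$: $R_4$ on $(X_4,X_5,X_6,X_7)$, abelian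 radical. * $L_{7.3}=L_{7.3}^p$, $p\in\mathbb R$, $p\ne0$: $D_{1/2}$ on $(X_4,X_5)$; $[X_4,X_7]=X_4$, $[X_5,X_7]=X_5$, $[X_6,X_7]=pX_6$. * $L_{7.4}$: $D_{1/2}$ on $(X_4,X_5)$; $[X_4,X_5]=X_6$, $[X_4,X_7]=X_4$, $[X_5,X_7]=X_5$, $[X_6,X_7]=2X_6$. * $L_{7.5}$: $D_1$ on $(X_4,X_5,X_6)$; $[X_i,X_7]=X_i$ for $i=4,5,6$. * $L_{7.6}$: $D_{3/2}$ on $(X_4,X_5,X_6,X_7)$, abelian radical. * $L_{7.7}$: $D_{1/2}$ on $(X_4,X_5)$ and $D_{1/2}$ on $(X_6,X_7)$, abelian radical. Then $\mu=3$ for $L_{5.1}$ and $L_{6.3}$; $\mu=4$ for $L_{6.1},L_{6.2},L_{6.4},L_{7.1},L_{7.4},L_{7.5},L_{7.7}$ and for $L_{7.3}^p$ for every $p\neq0$; and $\mu=5$ for $L_{7.2}$ and $L_{7.6}$. Moreover, each of the following sets of matrices ($a,b,c,d,e,f,g$ range over $\mathbb R$) is the image of a faithful representation of the algebra named: * $L_{5.1}$: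 $\begin{pmatrix}a&b&d\\c&-a&e\\0&0&0\end{pmatrix}$ * $L_{6.1}$: $\begin{pmatrix}0&c&-b&d\\-c&0&a&e\\b&-a&0&f\\0&0&0&0\end{pmatrix}$ * $L_{6.2}$: $\begin{pmatrix}a&b&0&d\\c&-a&0&e\\e&-d&0&f\\0&0&0&0\end{pmatrix}$ * $L_{6.3}$, for all real $\lambda\neq\mu$: $\begin{pmatrix}a+\lambda f&b&d\\-c&\lambda f-a&e\\0&0&\mu f\end{pmatrix}$ * $L_{6.4}$: $\begin{pmatrix}2a&2b&0&d\\c&0&b&e\\0&2c&-2a&f\\0&0&0&0\end{pmatrix}$, and also $\begin{pmatrix}a&b&d&e\\c&-a&f&-d\\0&0&a&b\\0&0&c&-a\end{pmatrix}$ * $L_{7.1}$, for all real $\lambda\ne\mu$: $\begin{pmatrix}\lambda g&c&-b&d\\-c&\lambda g&a&e\\b&-a&\lambda g&f\\0&0&0&\mu g\end{pmatrix}$ * $L_{7.2}$: $\begin{pmatrix}0&-a&-b&-c&d\\a&0&-c&b&e\\b&c&0&-a&f\\c&-b&a&0&g\\0&0&0&0&0\end{pmatrix}$ * $L_{7.3}^p$,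 for all real $\lambda\neq\mu$ with $p=\frac1{\lambda-\mu}$: $\begin{pmatrix}a+\lambda g&b&0&d\\c&\lambda g-a&0&e\\0&0&(\mu+1)g&f\\0&0&0&\mu g\end{pmatrix}$ * $L_{7.4}$, for all real $\lambda\neq\mu$: $\begin{pmatrix}a+\lambda g&b&0&d\\c&\lambda g-a&0&e\\-e&d&\mu g&f\\0&0&0&(2\lambda-\mu)g\end{pmatrix}$ * $L_{7.5}$, for all real $\lambda\neq\mu$: $\begin{pmatrix}2a+\lambda g&2c&0&f\\b&\lambda g&c&e\\0&2b&\lambda g-2a&d\\0&0&0&\mu g\end{pmatrix}$, and also, for all real $\lambda\neq1$: $\begin{pmatrix}a+g&b&-e&d\\c&g-a&f&e\\0&0&a+\lambda g&b\\0&0&c&\lambda g-a\end{pmatrix}$ * $L_{7.6}$: $\begin{pmatrix}3a&3b&0&0&d\\c&a&2b&0&e\\0&2c&-a&b&f\\0&0&3c&-3a&g\\0&0&0&0&0\end{pmatrix}$ * $L_{7.7}$: $\begin{pmatrix}a&b&d&f\\c&-a&e&g\\0&0&0&0\\0&0&0&0\end{pmatrix}$ -/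

import Mathlib

attribute [local instance] LieRing.ofAssociativeRing

/-- The bracket on `ℝⁿ` given by a list of structure constants.  An entry `(i, j, k, c)` says that
the product `[X_i, X_j]` of basis vectors contains the term `c X_k`; several entries with the same
`i, j` are added up, and brackets of basis vectors that are not listed (up to antisymmetry)
vanish. -/
def tableBracket {n : ℕ} (rel : List (Fin n × Fin n × Fin n × ℝ)) (x y : Fin n → ℝ) :
    Fin n → ℝ :=
  fun l => (rel.map fun r =>
    if r.2.2.1 = l then r.2.2.2 * (x r.1 * y r.2.1 - x r.2.1 * y r.1) else 0).sum

/-- A list of structure constants satisfying the Jacobi identity. -/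
structure LieTable (n : ℕ) where
  rel : List (Fin n × Fin n × Fin n × ℝ)
  jacobi : ∀ x y z : Fin n → ℝ,
    tableBracket rel x (tableBracket rel y z) =
      tableBracket rel (tableBracket rel x y) z + tableBracket rel y (tableBracket rel x z)

/-- The `n`-dimensional real Lie algebra with the given structure constants. -/
def LieTable.Alg {n : ℕ} (_T : LieTable n) : Type := Fin n → ℝ

section LieTableInstances

variable {n : ℕ} (T : LieTable n)

noncomputable instance : AddCommGroup T.Alg := inferInstanceAs (AddCommGroup (Fin n → ℝ))

noncomputable instance : Module ℝ T.Alg := inferInstanceAs (Module ℝ (Fin n → ℝ))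

theorem tableBracket_add_left (rel : List (Fin n × Fin n × Fin n × ℝ)) (x y z : Fin n → ℝ) :
    tableBracket rel (x + y) z = tableBracket rel x z + tableBracket rel y z := by
  funext l
  simp only [tableBracket, Pi.add_apply]
  induction rel with
  | nil => simp
  | cons r rs ih =>
    simp only [List.map_cons, List.sum_cons, ih]
    split_ifs <;> ring

theorem tableBracket_self (rel : List (Fin n × Fin n × Fin n × ℝ)) (x : Fin n → ℝ) :
    tableBracket rel x x = 0 := by
  funext l
  simp only [tableBracket, Pi.zero_apply]
  induction rel with
  | nil => simp
  | cons r rs ih =>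
    simp only [List.map_cons, List.sum_cons, ih]
    split_ifs <;> ring

theorem tableBracket_add_right (rel : List (Fin n × Fin n × Fin n × ℝ)) (x y z : Fin n → ℝ) :
    tableBracket rel x (y + z) = tableBracket rel x y + tableBracket rel x z := by
  funext l
  simp only [tableBracket, Pi.add_apply]
  induction rel with
  | nil => simp
  | cons r rs ih =>
    simp only [List.map_cons, List.sum_cons, ih]
    split_ifs <;> ring

theorem tableBracket_smul_right (rel : List (Fin n × Fin n × Fin n × ℝ)) (t : ℝ)
    (x y : Fin n → ℝ) :
    tableBracket rel x (t • y) = t • tableBracket rel x y := by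
  funext l
  simp only [tableBracket, Pi.smul_apply, smul_eq_mul]
  induction rel with
  | nil => simp
  | cons r rs ih =>
    simp only [List.map_cons, List.sum_cons, ih]
    split_ifs <;> ring

noncomputable instance : LieRing T.Alg where
  bracket x y := tableBracket T.rel x y
  add_lie x y z := tableBracket_add_left T.rel x y z
  lie_add x y z := tableBracket_add_right T.rel x y z
  lie_self x := tableBracket_self T.rel x
  leibniz_lie x y z := T.jacobi x y z

noncomputable instance : LieAlgebra ℝ T.Alg where
  lie_smul t x y := tableBracket_smul_right T.rel t x y

end LieTableInstances

/-- The set of all `n` for which `L` has a faithful representation in `gl(n, ℝ)`.  The least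
element of this set is the invariant `μ(L)`. -/
def faithfulDims (L : Type*) [LieRing L] [LieAlgebra ℝ L] : Set ℕ :=
  {n | ∃ φ : L →ₗ⁅ℝ⁆ Matrix (Fin n) (Fin n) ℝ, Function.Injective φ}

/-- The set `S` of matrices is the image of a faithful representation of `L`, i.e. `S` is a Lie
subalgebra of `gl(n, ℝ)` that is isomorphic to `L`. -/
def IsFaithfulImage (L : Type*) [LieRing L] [LieAlgebra ℝ L] {n : ℕ}
    (S : Set (Matrix (Fin n) (Fin n) ℝ)) : Prop :=
  ∃ φ : L →ₗ⁅ℝ⁆ Matrix (Fin n) (Fin n) ℝ, Function.Injective φ ∧ Set.range φ = S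

/-! ### The algebras with a non-trivial Levi decomposition in dimensions five, six and seven

The basis is `X_0, …, X_{n-1}`.  The first three vectors span the Levi factor, either
`sl(2, ℝ)` : `[X_0,X_1] = 2X_1`, `[X_0,X_2] = -2X_2`, `[X_1,X_2] = X_0`, or
`so(3)` : `[X_0,X_1] = X_2`, `[X_1,X_2] = X_0`, `[X_0,X_2] = -X_1`;
the other vectors span the radical. -/

/-- `sl(2, ℝ) ⋉ ℝ²`; the radical is the standard module `D_{1/2}`. -/
noncomputable def L51 : LieTable 5 where
  rel := [(0, 1, 1, 2), (0, 2, 2, -2), (1, 2, 0, 1),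
    (0, 3, 3, 1), (0, 4, 4, -1), (1, 4, 3, 1), (2, 3, 4, 1)]
  jacobi x y z := by
    funext l
    fin_cases l <;> simp [tableBracket] <;> ring

/-- `so(3) ⋉ ℝ³`; the radical is the standard module `R_3`. -/
noncomputable def L61 : LieTable 6 where
  rel := [(0, 1, 2, 1), (1, 2, 0, 1), (0, 2, 1, -1),
    (0, 4, 5, 1), (0, 5, 4, -1), (1, 5, 3, 1), (1, 3, 5, -1), (2, 3, 4, 1), (2, 4, 3, -1)]
  jacobi x y z := by
    funext l
    fin_cases l <;> simp [tableBracket] <;> ring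

/-- `sl(2, ℝ) ⋉ A_{3.1}`; the radical is the Heisenberg algebra `[X_3,X_4] = X_5` and the module
`D_{1/2} ⊕ D_0`. -/
noncomputable def L62 : LieTable 6 where
  rel := [(0, 1, 1, 2), (0, 2, 2, -2), (1, 2, 0, 1),
    (0, 3, 3, 1), (0, 4, 4, -1), (1, 4, 3, 1), (2, 3, 4, 1),
    (3, 4, 5, 1)]
  jacobi x y z := by
    funext l
    fin_cases l <;> simp [tableBracket] <;> ring

/-- `sl(2, ℝ) ⋉ A_{3.3}`; the radical is `[X_3,X_5] = X_3`, `[X_4,X_5] = X_4` and the module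
`D_{1/2} ⊕ D_0`. -/
noncomputable def L63 : LieTable 6 where
  rel := [(0, 1, 1, 2), (0, 2, 2, -2), (1, 2, 0, 1),
    (0, 3, 3, 1), (0, 4, 4, -1), (1, 4, 3, 1), (2, 3, 4, 1),
    (3, 5, 3, 1), (4, 5, 4, 1)]
  jacobi x y z := by
    funext l
    fin_cases l <;> simp [tableBracket] <;> ring

/-- `sl(2, ℝ) ⋉ ℝ³`; the radical is the irreducible module `D_1`. -/
noncomputable def L64 : LieTable 6 where
  rel := [(0, 1, 1, 2), (0, 2, 2, -2), (1, 2, 0, 1),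
    (0, 3, 3, 2), (0, 5, 5, -2), (1, 4, 3, 2), (1, 5, 4, 1), (2, 3, 4, 1), (2, 4, 5, 2)]
  jacobi x y z := by
    funext l
    fin_cases l <;> simp [tableBracket] <;> ring

/-- `so(3) ⋉ A_{4.5}` with `a = b = 1`; the radical is `[X_i,X_6] = X_i` for `i = 3, 4, 5` and the
module `R_3 ⊕ R_1`, with `R_1` trivial. -/
noncomputable def L71 : LieTable 7 where
  rel := [(0, 1, 2, 1), (1, 2, 0, 1), (0, 2, 1, -1),
    (0, 4, 5, 1), (0, 5, 4, -1), (1, 5, 3, 1), (1, 3, 5, -1), (2, 3, 4, 1), (2, 4, 3, -1),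
    (3, 6, 3, 1), (4, 6, 4, 1), (5, 6, 5, 1)]
  jacobi x y z := by
    funext l
    fin_cases l <;> simp [tableBracket] <;> ring

/-- `so(3) ⋉ ℝ⁴`; the radical is the irreducible real module `R_4`: the quaternions, on which
`X_0, X_1, X_2` act as left multiplication by `i/2, j/2, k/2`. -/
noncomputable def L72 : LieTable 7 where
  rel := [(0, 1, 2, 1), (1, 2, 0, 1), (0, 2, 1, -1),
    (0, 3, 4, 1 / 2), (0, 4, 3, -1 / 2), (0, 5, 6, 1 / 2), (0, 6, 5, -1 / 2),
    (1, 3, 5, 1 / 2), (1, 4, 6, -1 / 2), (1, 5, 3, -1 / 2), (1, 6, 4, 1 / 2),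
    (2, 3, 6, 1 / 2), (2, 4, 5, 1 / 2), (2, 5, 4, -1 / 2), (2, 6, 3, -1 / 2)]
  jacobi x y z := by
    funext l
    fin_cases l <;> simp [tableBracket] <;> ring

/-- `sl(2, ℝ) ⋉ A_{4.5}` with `a = 1`; the radical is `[X_3,X_6] = X_3`, `[X_4,X_6] = X_4`,
`[X_5,X_6] = p X_5` and the module `D_{1/2} ⊕ 2D_0`.  The parameter is non-zero in the
classification. -/
noncomputable def L73 (p : ℝ) : LieTable 7 where
  rel := [(0, 1, 1, 2), (0, 2, 2, -2), (1, 2, 0, 1),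
    (0, 3, 3, 1), (0, 4, 4, -1), (1, 4, 3, 1), (2, 3, 4, 1),
    (3, 6, 3, 1), (4, 6, 4, 1), (5, 6, 5, p)]
  jacobi x y z := by
    funext l
    fin_cases l <;> simp [tableBracket] <;> ring

/-- `sl(2, ℝ) ⋉ A_{4.9}` with `b = 1`; the radical is `[X_3,X_4] = X_5`, `[X_3,X_6] = X_3`,
`[X_4,X_6] = X_4`, `[X_5,X_6] = 2X_5` and the module `D_{1/2} ⊕ 2D_0`. -/
noncomputable def L74 : LieTable 7 where
  rel := [(0, 1, 1, 2), (0, 2, 2, -2), (1, 2, 0, 1),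
    (0, 3, 3, 1), (0, 4, 4, -1), (1, 4, 3, 1), (2, 3, 4, 1),
    (3, 4, 5, 1), (3, 6, 3, 1), (4, 6, 4, 1), (5, 6, 5, 2)]
  jacobi x y z := by
    funext l
    fin_cases l <;> simp [tableBracket] <;> ring

/-- `sl(2, ℝ) ⋉ A_{4.5}` with `a = b = 1`; the radical is `[X_i,X_6] = X_i` for `i = 3, 4, 5` and
the module `D_1 ⊕ D_0`. -/
noncomputable def L75 : LieTable 7 where
  rel := [(0, 1, 1, 2), (0, 2, 2, -2), (1, 2, 0, 1),
    (0, 3, 3, 2), (0, 5, 5, -2), (1, 4, 3, 2), (1, 5, 4, 1), (2, 3, 4, 1), (2, 4, 5, 2),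
    (3, 6, 3, 1), (4, 6, 4, 1), (5, 6, 5, 1)]
  jacobi x y z := by
    funext l
    fin_cases l <;> simp [tableBracket] <;> ring

/-- `sl(2, ℝ) ⋉ ℝ⁴`; the radical is the irreducible module `D_{3/2}`. -/
noncomputable def L76 : LieTable 7 where
  rel := [(0, 1, 1, 2), (0, 2, 2, -2), (1, 2, 0, 1),
    (0, 3, 3, 3), (0, 4, 4, 1), (0, 5, 5, -1), (0, 6, 6, -3),
    (1, 4, 3, 3), (1, 5, 4, 2), (1, 6, 5, 1), (2, 3, 4, 1), (2, 4, 5, 2), (2, 5, 6, 3)]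
  jacobi x y z := by
    funext l
    fin_cases l <;> simp [tableBracket] <;> ring

/-- `sl(2, ℝ) ⋉ ℝ⁴`; the radical is the module `2D_{1/2}`. -/
noncomputable def L77 : LieTable 7 where
  rel := [(0, 1, 1, 2), (0, 2, 2, -2), (1, 2, 0, 1),
    (0, 3, 3, 1), (0, 4, 4, -1), (1, 4, 3, 1), (2, 3, 4, 1),
    (0, 5, 5, 1), (0, 6, 6, -1), (1, 6, 5, 1), (2, 5, 6, 1)]
  jacobi x y z := by
    funext l
    fin_cases l <;> simp [tableBracket] <;> ring

/-!
For each algebra the upper bound is one of the explicit representations. Every set of matrices in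
the theorem is parametrized linearly by coordinates with respect to the basis of the algebra
(`isFaithfulImage_of_coordinates`), and the compatibility with brackets is a computation.

For the lower bounds, a faithful representation may be enlarged by a trivial summand
(`faithfulDims_upward_closed`), so it suffices to exclude one dimension. For the value `3` this is a
count of dimensions: `gl(2)` has dimension four. The other cases use the complexified Levi factor,
which contains an `sl₂`-triple `h, e, f`.

* The eigenvalues of `h` are integers that come in unbroken symmetric strings
  (`IsSl2Triple.exists_int_weight`), and a non-zero operator of weight `c` for `ad h` joins two
  eigenvalues with difference `c` (`exists_hasEigenvalue_add`). An operator of weight three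
  therefore needs five eigenvalues (`IsSl2Triple.five_le_finrank`), which excludes `gl(4)` for the
  radical `D_{3/2}`.
* On a three-dimensional space `h` becomes `diag(1, 0, -1)` or `diag(2, 0, -2)`
  (`IsSl2Triple.exists_algEquiv_diagonal`), and operators of a given weight have few non-zero
  entries. So a highest weight vector of weight two is a multiple of `e`, which excludes `gl(3)`
  when the radical contains `D₁` or, over the reals, `R₃` (`IsSl2Triple.eq_smul_of_weight_two`); a commutator
  commuting with `h`, `e` and an operator of weight one vanishes, which excludes it for the
  Heisenberg algebra and for an additional one-dimensional ideal (`IsSl2Triple.eq_zero_of_commute`);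
  and `2D_{1/2}` with abelian radical does not occur (`IsSl2Triple.eq_smul_of_weight_one`).
* The radical `R₄` of `so(3)` needs weights of both parities. In dimension four these are
  `1, 0, 0, -1`, so over `ℂ` there is one summand `D_{1/2}`. Complex conjugation would preserve it
  and give `so(3)` a non-trivial two-dimensional real representation, which positivity of
  `|c|²` forbids (`IsSl2Triple.eq_zero_of_weight_one_of_conj`).
-/

open Module

/-! ### Weights of `sl₂`-triples -/

section Weights

variable {K V : Type*} [Field K] [CharZero K] [AddCommGroup V] [Module K V]
  [FiniteDimensional K V] {h e f : End K V}

/-- Raising an eigenvector of `h` as far as possible gives a primitive vector, whose eigenvalue `m`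
is a natural number, and lowering that one gives the eigenvalues `m, m - 2, …, -m`. -/
theorem IsSl2Triple.exists_weight_string (t : IsSl2Triple h e f) {μ : K}
    (hμ : h.HasEigenvalue μ) :
    ∃ m k : ℕ, μ = m - 2 * k ∧ ∀ j ≤ m, h.HasEigenvalue ((m : K) - 2 * j) := by
  obtain ⟨v, hv⟩ := hμ.exists_hasEigenvector
  have hv' : ⁅h, v⁆ = μ • v := hv.apply_eq_smul
  have hex : ∃ k : ℕ, ((LieModule.toEnd K (End K V) V e) ^ k) v = 0 := by
    by_contra! contra
    have h_inj : Function.Injective (fun n : ℕ => μ + 2 * (n : K)) := fun a b hab => by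
      simpa using hab
    have aux (ν : Set.range (fun n : ℕ => μ + 2 * (n : K))) :
        h.HasEigenvector ν (((LieModule.toEnd K (End K V) V e) ^ ν.property.choose) v) := by
      refine ⟨?_, contra _⟩
      rw [Module.End.mem_eigenspace_iff]
      exact (t.lie_h_pow_toEnd_e hv' _).trans (congrArg (· • _) ν.property.choose_spec)
    have := (h.eigenvectors_linearIndependent _ _ aux).finite
    exact (Set.infinite_range_of_injective h_inj) (Set.toFinite _)
  obtain ⟨k, hk, hk'⟩ := Nat.exists_not_and_succ_of_not_zero_of_exists (by simpa using hv.2) hex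
  have P : t.HasPrimitiveVectorWith (((LieModule.toEnd K (End K V) V e) ^ k) v) (μ + 2 * k) :=
    { ne_zero := hk
      lie_h := t.lie_h_pow_toEnd_e hv' k
      lie_e := by rw [IsSl2Triple.lie_e_pow_toEnd_e (R := K) k]; exact hk' }
  obtain ⟨m, hm⟩ := P.exists_nat
  refine ⟨m, k, by rw [← hm]; ring, fun j hj => ?_⟩
  refine End.hasEigenvalue_of_hasEigenvector
    ⟨?_, P.pow_toEnd_f_ne_zero_of_eq_nat hm hj⟩
  rw [Module.End.mem_eigenspace_iff, ← hm]
  exact P.lie_h_pow_toEnd_f j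

/-- The eigenvalues of `h` are integers, and they come in unbroken symmetric strings. -/
theorem IsSl2Triple.exists_int_weight (t : IsSl2Triple h e f) {μ : K} (hμ : h.HasEigenvalue μ) :
    ∃ z : ℤ, μ = z ∧ ∀ w : ℤ, w.natAbs ≤ z.natAbs → 2 ∣ z - w → h.HasEigenvalue (w : K) := by
  obtain ⟨m, k, rfl, hm⟩ := t.exists_weight_string hμ
  refine ⟨m - 2 * k, by push_cast; rfl, fun w hw hd => ?_⟩
  have hneg : ∀ {ν : K}, h.HasEigenvalue ν → (-h).HasEigenvalue (-ν) := by
    intro ν hν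
    obtain ⟨v, hv⟩ := hν.exists_hasEigenvector
    refine End.hasEigenvalue_of_hasEigenvector (x := v) ⟨?_, hv.2⟩
    rw [Module.End.mem_eigenspace_iff]
    simp [hv.apply_eq_smul]
  have hneg' : ∀ {ν : K}, (-h).HasEigenvalue ν → h.HasEigenvalue (-ν) := by
    intro ν hν
    obtain ⟨v, hv⟩ := hν.exists_hasEigenvector
    refine End.hasEigenvalue_of_hasEigenvector (x := v) ⟨?_, hv.2⟩
    rw [Module.End.mem_eigenspace_iff]
    have := hv.apply_eq_smul
    simp only [LinearMap.neg_apply] at this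
    rw [neg_smul, ← this, neg_neg]
  by_cases hkm : k ≤ m
  · have := hm (((m : ℤ) - w) / 2).toNat (by omega)
    convert this using 1
    have h2 : (w : ℤ) = m - 2 * ((((m : ℤ) - w) / 2).toNat : ℤ) := by omega
    exact_mod_cast congrArg (Int.cast : ℤ → K) h2
  · -- a weight below `-m`: use the string of the opposite triple, which starts at the other end
    obtain ⟨m', k', h', hm'⟩ := t.symm.exists_weight_string (hneg hμ)
    have h'' : -((m : ℤ) - 2 * k) = m' - 2 * k' := by
      have : ((-((m : ℤ) - 2 * k) : ℤ) : K) = ((m' - 2 * k' : ℤ) : K) := by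
        push_cast; exact h'
      exact_mod_cast this
    have := hneg' (hm' (((m' : ℤ) + w) / 2).toNat (by omega))
    convert this using 1
    have h2 : (w : ℤ) = -(m' - 2 * ((((m' : ℤ) + w) / 2).toNat : ℤ)) := by omega
    exact_mod_cast congrArg (Int.cast : ℤ → K) h2

omit [CharZero K] in
/-- An operator of weight `c` for `ad h` maps the generalized eigenspace of `h` at `μ` into the one
at `μ + c`. -/
theorem exists_hasEigenvalue_add [IsAlgClosed K] {u : End K V} {c : K} (hu : h * u - u * h = c • u)
    (u0 : u ≠ 0) : ∃ μ : K, h.HasEigenvalue μ ∧ h.HasEigenvalue (μ + c) := by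
  obtain ⟨μ, v, hv, huv⟩ : ∃ μ : K, ∃ v ∈ h.maxGenEigenspace μ, u v ≠ 0 := by
    by_contra! H
    apply u0
    have : (⨆ μ : K, h.maxGenEigenspace μ) ≤ LinearMap.ker u :=
      iSup_le fun μ v hv => H μ v hv
    rw [End.iSup_maxGenEigenspace_eq_top, top_le_iff] at this
    exact LinearMap.ker_eq_top.mp this
  have key : ∀ (ν : K) (w : V), w ∈ h.maxGenEigenspace ν → w ≠ 0 → h.HasEigenvalue ν := by
    intro ν w hw w0
    obtain ⟨k, hk⟩ := (End.mem_maxGenEigenspace _ _ _).1 hw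
    refine End.hasEigenvalue_of_hasGenEigenvalue (k := k) ?_
    intro h0
    apply w0
    have : w ∈ h.genEigenspace ν k := (End.mem_genEigenspace_nat).2 hk
    rw [h0] at this
    simpa using this
  refine ⟨μ, key μ v hv (by rintro rfl; simp at huv), key _ (u v) ?_ huv⟩
  obtain ⟨k, hk⟩ := (End.mem_maxGenEigenspace _ _ _).1 hv
  rw [End.mem_maxGenEigenspace]
  refine ⟨k, ?_⟩
  have hs : SemiconjBy u (h - μ • 1) (h - (μ + c) • 1) := by
    unfold SemiconjBy
    have : h * u = u * h + c • u := by rw [← hu]; abel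
    rw [mul_sub, sub_mul, this, smul_mul_assoc, mul_smul_comm, one_mul, mul_one, add_smul]
    abel
  have := congrArg (fun g : End K V => g v) (hs.pow_right k).eq
  simp only [Module.End.mul_apply, hk, map_zero] at this
  exact this.symm

omit [CharZero K] in
theorem card_le_finrank_of_hasEigenvalue (s : Finset K) (hs : ∀ μ ∈ s, h.HasEigenvalue μ) :
    s.card ≤ finrank K V := by
  choose! v hv using fun μ hμ => (hs μ hμ).exists_hasEigenvector
  have := h.eigenvectors_linearIndependent (s : Set K) (fun μ => v μ) (fun μ => hv μ μ.2)
  simpa using this.fintype_card_le_finrank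

theorem card_le_finrank_of_hasEigenvalue_int (s : Finset ℤ)
    (hs : ∀ z ∈ s, h.HasEigenvalue (z : K)) : s.card ≤ finrank K V := by
  classical
  rw [← Finset.card_image_of_injective s (Int.cast_injective (α := K))]
  refine card_le_finrank_of_hasEigenvalue (h := h) _ fun μ hμ => ?_
  obtain ⟨z, hz, rfl⟩ := Finset.mem_image.1 hμ
  exact hs z hz

/-- An operator of weight `3` joins weights of different parity at distance three, and their two
strings have at least five members. -/
theorem IsSl2Triple.five_le_finrank [IsAlgClosed K] (t : IsSl2Triple h e f) {u : End K V}
    (hu : h * u - u * h = (3 : K) • u) (u0 : u ≠ 0) : 5 ≤ finrank K V := by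
  obtain ⟨μ, h1, h2⟩ := exists_hasEigenvalue_add hu u0
  obtain ⟨z, rfl, hz⟩ := t.exists_int_weight h1
  obtain ⟨z', h', hz'⟩ := t.exists_int_weight h2
  obtain rfl : z' = z + 3 := by exact_mod_cast h'.symm
  have H : ∀ w : ℤ, (w.natAbs ≤ z.natAbs ∧ 2 ∣ z - w) ∨
      (w.natAbs ≤ (z + 3).natAbs ∧ 2 ∣ z + 3 - w) → h.HasEigenvalue (w : K) := by
    rintro w (hw | hw)
    · exact hz w hw.1 hw.2
    · exact hz' w hw.1 hw.2
  have H5 : (∀ w ∈ ({-4, -2, 0, 2, 4} : Finset ℤ), h.HasEigenvalue (w : K)) ∨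
      (∀ w ∈ ({-3, -1, 0, 1, 3} : Finset ℤ), h.HasEigenvalue (w : K)) ∨
      (∀ w ∈ ({-2, -1, 0, 1, 2} : Finset ℤ), h.HasEigenvalue (w : K)) := by
    by_cases h1 : z = -1 ∨ z = -2
    · refine Or.inr (Or.inr fun w hw => H w ?_)
      simp only [Finset.mem_insert, Finset.mem_singleton] at hw
      omega
    · by_cases h2 : (0 ≤ z ∧ 2 ∣ z) ∨ (z < 0 ∧ ¬ 2 ∣ z)
      · refine Or.inr (Or.inl fun w hw => H w ?_)
        simp only [Finset.mem_insert, Finset.mem_singleton] at hw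
        omega
      · refine Or.inl fun w hw => H w ?_
        simp only [Finset.mem_insert, Finset.mem_singleton] at hw
        omega
  rcases H5 with H5 | H5 | H5 <;> exact card_le_finrank_of_hasEigenvalue_int _ H5

end Weights

/-! ### Diagonalization and weights of matrices -/

section Diagonalization

theorem IsSl2Triple.map_algEquiv {R A B : Type*} [CommRing R] [Ring A] [Ring B] [Algebra R A]
    [Algebra R B] {h e f : A} (t : IsSl2Triple h e f) (ψ : A ≃ₐ[R] B) :
    IsSl2Triple (ψ h) (ψ e) (ψ f) where
  h_ne_zero := by simpa using t.h_ne_zero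
  lie_e_f := by
    have := congrArg ψ t.lie_e_f
    simpa [LieRing.of_associative_ring_bracket] using this
  lie_h_e_nsmul := by
    have := congrArg ψ t.lie_h_e_nsmul
    simpa only [LieRing.of_associative_ring_bracket, map_sub, map_mul, map_nsmul] using this
  lie_h_f_nsmul := by
    have := congrArg ψ t.lie_h_f_nsmul
    simpa only [LieRing.of_associative_ring_bracket, map_sub, map_mul, map_nsmul, map_neg]
      using this

variable {K : Type*} [Field K] {n : ℕ}

theorem exists_algEquiv_eq_diagonal (h : Matrix (Fin n) (Fin n) K) (d : Fin n → K)
    (hd : Function.Injective d) (hh : ∀ i, End.HasEigenvalue (Matrix.toLinAlgEquiv' h) (d i)) :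
    ∃ ψ : Matrix (Fin n) (Fin n) K ≃ₐ[K] Matrix (Fin n) (Fin n) K, ψ h = Matrix.diagonal d := by
  choose v hv using fun i => (hh i).exists_hasEigenvector
  have li := End.eigenvectors_linearIndependent' (Matrix.toLinAlgEquiv' h) d hd v hv
  rcases Nat.eq_zero_or_pos n with rfl | hn
  · exact ⟨AlgEquiv.refl, Subsingleton.elim _ _⟩
  have : Nonempty (Fin n) := ⟨⟨0, hn⟩⟩
  let b := basisOfLinearIndependentOfCardEqFinrank li (by simp)
  have hb : ∀ i, b i = v i := fun i => by simp [b]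
  refine ⟨Matrix.toLinAlgEquiv'.trans (LinearMap.toMatrixAlgEquiv b), ?_⟩
  ext i j
  simp only [AlgEquiv.trans_apply, LinearMap.toMatrixAlgEquiv_apply]
  have h1 := (hv j).apply_eq_smul
  rw [← hb] at h1
  rw [h1, map_smul, Basis.repr_self]
  by_cases hij : i = j
  · subst hij; simp
  · simp [hij, Matrix.diagonal_apply_ne]

theorem diagonal_commutator_apply (d : Fin n → K) (x : Matrix (Fin n) (Fin n) K) (i j : Fin n) :
    (Matrix.diagonal d * x - x * Matrix.diagonal d) i j = (d i - d j) * x i j := by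
  simp [Matrix.diagonal_mul, Matrix.mul_diagonal]; ring

/-- An operator of weight `c` has no entries outside the positions of weight `c`. -/
theorem apply_eq_zero_of_weight {d : Fin n → K} {x : Matrix (Fin n) (Fin n) K} {c : K}
    (hx : Matrix.diagonal d * x - x * Matrix.diagonal d = c • x) {i j : Fin n}
    (hij : d i - d j ≠ c) : x i j = 0 := by
  have h1 := diagonal_commutator_apply d x i j
  rw [hx, Matrix.smul_apply, smul_eq_mul] at h1
  have h2 : (d i - d j - c) * x i j = 0 := by rw [sub_mul, ← h1, sub_self]
  exact (mul_eq_zero.1 h2).resolve_left (sub_ne_zero.2 hij)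

end Diagonalization

section Roots

theorem hasEigenvalue_iff_mem_roots {n : ℕ} {h : Matrix (Fin n) (Fin n) ℂ} {μ : ℂ} :
    End.HasEigenvalue (Matrix.toLinAlgEquiv' h) μ ↔ μ ∈ h.charpoly.roots := by
  rw [End.hasEigenvalue_iff_isRoot_charpoly,
    Polynomial.mem_roots (Matrix.charpoly_monic h).ne_zero,
    ← Matrix.charpoly_toLin' h]
  rfl

theorem card_roots_charpoly {n : ℕ} (h : Matrix (Fin n) (Fin n) ℂ) :
    h.charpoly.roots.card = n := by
  rw [← (IsAlgClosed.splits h.charpoly).natDegree_eq_card_roots,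
    Matrix.charpoly_natDegree_eq_dim, Fintype.card_fin]

theorem IsSl2Triple.sum_roots_charpoly {n : ℕ} {h e f : Matrix (Fin n) (Fin n) ℂ}
    (t : IsSl2Triple h e f) : h.charpoly.roots.sum = 0 := by
  rw [← Matrix.trace_eq_sum_roots_charpoly, ← t.lie_e_f,
    LieRing.of_associative_ring_bracket, Matrix.trace_sub, Matrix.trace_mul_comm, sub_self]

end Roots

/-! ### Three-dimensional representations -/

section ThreeByThree

variable {h e f : Matrix (Fin 3) (Fin 3) ℂ}

/-- The element `h` of a triple acts on a three-dimensional space with weights `1, 0, -1` or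
`2, 0, -2`. Two weights `μ` and `μ + 2` are joined by `e`; if they are even, their strings contain
`2, 0, -2`, and if they are odd, they contain `1, -1`, and the vanishing trace of `h` gives the
third weight. -/
theorem IsSl2Triple.exists_algEquiv_diagonal (t : IsSl2Triple h e f) :
    ∃ ψ : Matrix (Fin 3) (Fin 3) ℂ ≃ₐ[ℂ] Matrix (Fin 3) (Fin 3) ℂ,
      ψ h = Matrix.diagonal ![1, 0, -1] ∨ ψ h = Matrix.diagonal ![2, 0, -2] := by
  have t' := t.map_algEquiv (Matrix.toLinAlgEquiv' (R := ℂ) (n := Fin 3))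
  have he := t'.lie_h_e_nsmul
  rw [LieRing.of_associative_ring_bracket] at he
  obtain ⟨μ, h1, h2⟩ := exists_hasEigenvalue_add (c := 2) (by rw [he, two_smul, two_smul])
    t'.e_ne_zero
  obtain ⟨z, rfl, hz⟩ := t'.exists_int_weight h1
  obtain ⟨z', h', hz'⟩ := t'.exists_int_weight h2
  obtain rfl : z' = z + 2 := by exact_mod_cast h'.symm
  have H : ∀ w : ℤ, (w.natAbs ≤ z.natAbs ∧ 2 ∣ z - w) ∨
      (w.natAbs ≤ (z + 2).natAbs ∧ 2 ∣ z + 2 - w) →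
      End.HasEigenvalue (Matrix.toLinAlgEquiv' h) (w : ℂ) := by
    rintro w (hw | hw)
    · exact hz w hw.1 hw.2
    · exact hz' w hw.1 hw.2
  by_cases hpar : 2 ∣ z
  · obtain ⟨ψ, hψ⟩ := exists_algEquiv_eq_diagonal h ![2, 0, -2]
      (by intro i j; fin_cases i <;> fin_cases j <;> norm_num) (by
        intro i
        fin_cases i
        · simpa using H 2 (by omega)
        · simpa using H 0 (by omega)
        · simpa using H (-2) (by omega))
    exact ⟨ψ, Or.inr hψ⟩
  · have m1 := hasEigenvalue_iff_mem_roots.1 (H 1 (by omega))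
    have m2 := hasEigenvalue_iff_mem_roots.1 (H (-1) (by omega))
    have htr := t.sum_roots_charpoly
    have hcard := card_roots_charpoly h
    have m0 : (0 : ℂ) ∈ h.charpoly.roots := by
      obtain ⟨s, hs⟩ := Multiset.exists_cons_of_mem m1
      rw [hs] at m2 htr hcard ⊢
      have m2' : ((-1 : ℤ) : ℂ) ∈ s :=
        (Multiset.mem_cons.1 m2).resolve_left (by norm_num)
      obtain ⟨s', rfl⟩ := Multiset.exists_cons_of_mem m2'
      simp only [Multiset.card_cons, Multiset.sum_cons] at hcard htr
      obtain ⟨a, rfl⟩ := Multiset.card_eq_one.1 (show s'.card = 1 by omega)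
      simp at htr
      simp [htr]
    obtain ⟨ψ, hψ⟩ := exists_algEquiv_eq_diagonal h ![1, 0, -1]
      (by
        intro i j
        fin_cases i <;> fin_cases j <;> norm_num) (by
        intro i
        fin_cases i
        · simpa using H 1 (by omega)
        · exact hasEigenvalue_iff_mem_roots.2 m0
        · simpa using H (-1) (by omega))
    exact ⟨ψ, Or.inl hψ⟩

theorem map_commutator {R A B : Type*} [CommRing R] [Ring A] [Ring B] [Algebra R A]
    [Algebra R B] (ψ : A ≃ₐ[R] B) {a b c : A} (habc : a * b - b * a = c) :
    ψ a * ψ b - ψ b * ψ a = ψ c := by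
  rw [← habc, map_sub, map_mul, map_mul]

theorem IsSl2Triple.commutator_h_e {R A : Type*} [CommRing R] [Ring A] [Algebra R A] {h e f : A}
    (t : IsSl2Triple h e f) : h * e - e * h = (2 : R) • e := by
  rw [← LieRing.of_associative_ring_bracket]
  exact t.lie_h_e_smul R

theorem IsSl2Triple.commutator_h_f {R A : Type*} [CommRing R] [Ring A] [Algebra R A] {h e f : A}
    (t : IsSl2Triple h e f) : h * f - f * h = (-2 : R) • f := by
  rw [← LieRing.of_associative_ring_bracket, neg_smul]
  exact t.lie_lie_smul_f R

/-! ### Matrices of a given weight -/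

section Shapes

variable {x : Matrix (Fin 3) (Fin 3) ℂ}

/-- The action of `h` on `D_{1/2} ⊕ D_0`. -/
local notation "H₁" => (Matrix.diagonal ![1, 0, -1] : Matrix (Fin 3) (Fin 3) ℂ)

/-- The action of `h` on `D_1`. -/
local notation "H₂" => (Matrix.diagonal ![2, 0, -2] : Matrix (Fin 3) (Fin 3) ℂ)

theorem weight_zero_shape (hx : H₁ * x - x * H₁ = (0 : ℂ) • x) :
    ∃ a b c : ℂ, x = !![a, 0, 0; 0, b, 0; 0, 0, c] := by
  refine ⟨x 0 0, x 1 1, x 2 2, ?_⟩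
  ext i j
  fin_cases i <;> fin_cases j <;>
    first | rfl | exact apply_eq_zero_of_weight hx (by norm_num)

theorem weight_one_shape (hx : H₁ * x - x * H₁ = (1 : ℂ) • x) :
    ∃ a b : ℂ, x = !![0, a, 0; 0, 0, b; 0, 0, 0] := by
  refine ⟨x 0 1, x 1 2, ?_⟩
  ext i j
  fin_cases i <;> fin_cases j <;>
    first | rfl | exact apply_eq_zero_of_weight hx (by norm_num)

theorem weight_two_shape (hx : H₁ * x - x * H₁ = (2 : ℂ) • x) :
    ∃ a : ℂ, x = !![0, 0, a; 0, 0, 0; 0, 0, 0] := by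
  refine ⟨x 0 2, ?_⟩
  ext i j
  fin_cases i <;> fin_cases j <;>
    first | rfl | exact apply_eq_zero_of_weight hx (by norm_num)

theorem weight_neg_two_shape (hx : H₁ * x - x * H₁ = (-2 : ℂ) • x) :
    ∃ a : ℂ, x = !![0, 0, 0; 0, 0, 0; a, 0, 0] := by
  refine ⟨x 2 0, ?_⟩
  ext i j
  fin_cases i <;> fin_cases j <;>
    first | rfl | exact apply_eq_zero_of_weight hx (by norm_num)

theorem weight_two_shape_even (hx : H₂ * x - x * H₂ = (2 : ℂ) • x) :
    ∃ a b : ℂ, x = !![0, a, 0; 0, 0, b; 0, 0, 0] := by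
  refine ⟨x 0 1, x 1 2, ?_⟩
  ext i j
  fin_cases i <;> fin_cases j <;>
    first | rfl | exact apply_eq_zero_of_weight hx (by norm_num)

theorem weight_one_eq_zero_even (hx : H₂ * x - x * H₂ = (1 : ℂ) • x) : x = 0 := by
  ext i j
  fin_cases i <;> fin_cases j <;> exact apply_eq_zero_of_weight hx (by norm_num)

end Shapes

/-! ### Relations forced by three-dimensional representations -/

/-- In dimension three, the adjoint module of `sl₂` occurs in the matrix algebra only as `sl₂`
itself, so that every other highest weight vector of weight two is a multiple of `e`. -/
theorem IsSl2Triple.eq_smul_of_weight_two (t : IsSl2Triple h e f)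
    {u : Matrix (Fin 3) (Fin 3) ℂ} (hu : h * u - u * h = (2 : ℂ) • u) (heu : e * u = u * e) :
    ∃ c : ℂ, u = c • e := by
  obtain ⟨ψ, hψ⟩ := t.exists_algEquiv_diagonal
  have t' := t.map_algEquiv ψ
  suffices ∃ c : ℂ, ψ u = c • ψ e by
    obtain ⟨c, hc⟩ := this
    exact ⟨c, ψ.injective (by rw [hc, map_smul])⟩
  have hu' := map_commutator ψ hu
  have heu' := congrArg ψ heu
  have he' := t'.commutator_h_e (R := ℂ)
  have hef := t'.lie_e_f
  have e0 := t'.e_ne_zero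
  simp only [map_mul, map_smul] at hu' heu'
  rw [LieRing.of_associative_ring_bracket] at hef
  rcases hψ with hψ | hψ
  · rw [hψ] at hu' he'
    obtain ⟨a, ha⟩ := weight_two_shape he'
    obtain ⟨b, hb⟩ := weight_two_shape hu'
    rw [ha] at e0
    have a0 : a ≠ 0 := by
      rintro rfl
      exact e0 (by ext i j; fin_cases i <;> fin_cases j <;> rfl)
    refine ⟨b / a, ?_⟩
    rw [ha, hb]
    simp [a0]
  · rw [hψ] at hu' he' hef
    obtain ⟨a, b, hab⟩ := weight_two_shape_even he'
    obtain ⟨a', b', hab'⟩ := weight_two_shape_even hu'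
    rw [hab] at hef heu'
    rw [hab'] at heu'
    have h00 := congrFun (congrFun hef 0) 0
    have h22 := congrFun (congrFun hef 2) 2
    have h02 := congrFun (congrFun heu' 0) 2
    simp [Matrix.mul_apply, Fin.sum_univ_three] at h00 h22 h02
    have a0 : a ≠ 0 := by rintro rfl; simp [Matrix.vecMul, dotProduct, Fin.sum_univ_three] at h00
    have b0 : b ≠ 0 := by rintro rfl; simp [Matrix.vecMul, dotProduct, Fin.sum_univ_three] at h22
    refine ⟨a' / a, ?_⟩
    have : b' = a' / a * b := by
      field_simp
      linear_combination h02
    rw [hab, hab']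
    simp [a0, this]

/-- An operator of weight one excludes the weights `2, 0, -2`. -/
theorem IsSl2Triple.exists_algEquiv_diagonal_of_weight_one (t : IsSl2Triple h e f)
    {x : Matrix (Fin 3) (Fin 3) ℂ} (hx : h * x - x * h = (1 : ℂ) • x) (x0 : x ≠ 0) :
    ∃ ψ : Matrix (Fin 3) (Fin 3) ℂ ≃ₐ[ℂ] Matrix (Fin 3) (Fin 3) ℂ,
      ψ h = Matrix.diagonal ![1, 0, -1] := by
  obtain ⟨ψ, hψ | hψ⟩ := t.exists_algEquiv_diagonal
  · exact ⟨ψ, hψ⟩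
  · have hx' := map_commutator ψ hx
    rw [hψ, map_smul] at hx'
    exact absurd ((map_eq_zero_iff ψ ψ.injective).1 (weight_one_eq_zero_even hx')) x0

/-- For the weights `1, 0, -1`, a matrix commuting with `h`, with `e` and with an operator of weight
one is scalar. -/
theorem IsSl2Triple.eq_zero_of_commute (t : IsSl2Triple h e f) {x z a b : Matrix (Fin 3) (Fin 3) ℂ}
    (hx : h * x - x * h = (1 : ℂ) • x) (x0 : x ≠ 0) (hz : h * z = z * h) (ez : e * z = z * e)
    (xz : x * z = z * x) (hab : z = a * b - b * a) : z = 0 := by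
  obtain ⟨ψ, hψ⟩ := t.exists_algEquiv_diagonal_of_weight_one hx x0
  have t' := t.map_algEquiv ψ
  have tr : (ψ z).trace = 0 := by
    rw [hab, map_sub, map_mul, map_mul, Matrix.trace_sub, Matrix.trace_mul_comm, sub_self]
  have hx' := map_commutator ψ hx
  have hz' := map_commutator ψ (sub_eq_zero.2 hz)
  have he' := t'.commutator_h_e (R := ℂ)
  have ez' := congrArg ψ ez
  have xz' := congrArg ψ xz
  have e0 := t'.e_ne_zero
  replace x0 := (map_ne_zero_iff ψ ψ.injective).2 x0
  apply (map_eq_zero_iff ψ ψ.injective).1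
  simp only [map_mul, map_zero, map_smul] at hz' ez' xz' hx'
  rw [← zero_smul ℂ (ψ z)] at hz'
  rw [hψ] at hx' hz' he'
  obtain ⟨p, hp⟩ := weight_two_shape he'
  obtain ⟨q, r, hqr⟩ := weight_one_shape hx'
  obtain ⟨u, v, w, huvw⟩ := weight_zero_shape hz'
  rw [hp, huvw] at ez'
  rw [hqr, huvw] at xz'
  rw [hp] at e0
  rw [hqr] at x0
  rw [huvw] at tr ⊢
  have c02 := congrFun (congrFun ez' 0) 2
  have c01 := congrFun (congrFun xz' 0) 1
  have c12 := congrFun (congrFun xz' 1) 2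
  simp [Matrix.mul_apply, Fin.sum_univ_three] at c02 c01 c12
  simp [Matrix.trace_fin_three] at tr
  have p0 : p ≠ 0 := by
    rintro rfl
    exact e0 (by ext i j; fin_cases i <;> fin_cases j <;> rfl)
  have huw : w = u := mul_left_cancel₀ p0 (by linear_combination c02)
  subst huw
  -- commuting with one of the two possible entries of `x` identifies the remaining eigenvalue
  have huv : v = w := by
    by_cases q0 : q = 0
    · have r0 : r ≠ 0 := by
        rintro rfl
        exact x0 (by subst q0; ext i j; fin_cases i <;> fin_cases j <;> rfl)
      exact mul_left_cancel₀ r0 (by linear_combination -c12)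
    · exact mul_left_cancel₀ q0 (by linear_combination c01)
  subst huv
  have hv : v = 0 := by linear_combination tr / 3
  subst hv
  ext i j; fin_cases i <;> fin_cases j <;> rfl

/-- In dimension three, two copies of the two-dimensional `sl₂`-module in the matrix algebra that
generate an abelian algebra coincide: for the weights `1, 0, -1` an operator of weight one
commuting with its `f`-image has a single non-zero entry, and two such with different positions do
not commute. -/
theorem IsSl2Triple.eq_smul_of_weight_one (t : IsSl2Triple h e f)
    {x x' : Matrix (Fin 3) (Fin 3) ℂ} (hx : h * x - x * h = (1 : ℂ) • x) (x0 : x ≠ 0)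
    (hx' : h * x' - x' * h = (1 : ℂ) • x')
    (xy : x * (f * x - x * f) = (f * x - x * f) * x)
    (xy' : x' * (f * x' - x' * f) = (f * x' - x' * f) * x')
    (xx' : x * x' = x' * x) :
    ∃ a : ℂ, x' = a • x := by
  obtain ⟨ψ, hψ⟩ := t.exists_algEquiv_diagonal_of_weight_one hx x0
  have t' := t.map_algEquiv ψ
  suffices ∃ c : ℂ, ψ x' = c • ψ x by
    obtain ⟨c, hc⟩ := this
    exact ⟨c, ψ.injective (by rw [hc, map_smul])⟩
  replace hx := map_commutator ψ hx
  replace hx' := map_commutator ψ hx'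
  replace xy := congrArg ψ xy
  replace xy' := congrArg ψ xy'
  replace xx' := congrArg ψ xx'
  replace x0 := (map_ne_zero_iff ψ ψ.injective).2 x0
  have f0 := t'.f_ne_zero
  have hf := t'.commutator_h_f (R := ℂ)
  simp only [map_mul, map_sub, map_smul] at xy xy' xx' hx hx'
  rw [hψ] at hx hx' hf
  obtain ⟨p, hp⟩ := weight_neg_two_shape hf
  obtain ⟨q, r, hqr⟩ := weight_one_shape hx
  obtain ⟨q', r', hqr'⟩ := weight_one_shape hx'
  rw [hp] at f0
  rw [hqr] at x0
  rw [hqr, hp] at xy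
  rw [hqr', hp] at xy'
  rw [hqr, hqr'] at xx'
  have p0 : p ≠ 0 := by
    rintro rfl
    exact f0 (by ext i j; fin_cases i <;> fin_cases j <;> rfl)
  have hne : q = 0 → r ≠ 0 := by
    rintro rfl rfl
    exact x0 (by ext i j; fin_cases i <;> fin_cases j <;> rfl)
  have c := congrFun (congrFun xy 1) 1
  have c' := congrFun (congrFun xy' 1) 1
  have cc := congrFun (congrFun xx' 0) 2
  simp [Matrix.mul_apply, Fin.sum_univ_three] at c c' cc
  -- `x` and its `f`-image commute only if `x` has a single entry
  have d : q * r = 0 := mul_left_cancel₀ p0 (by linear_combination c / 2)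
  have d' : q' * r' = 0 := mul_left_cancel₀ p0 (by linear_combination c' / 2)
  rw [hqr, hqr']
  by_cases q0 : q = 0
  · have r0 := hne q0
    subst q0
    have hq' : q' = 0 := by
      rcases mul_eq_zero.1 d' with h | h
      · exact h
      · simpa [r0] using cc
    exact ⟨r' / r, by simp [r0, hq']⟩
  · have hr : r = 0 := (mul_eq_zero.1 d).resolve_left q0
    subst hr
    have hr' : r' = 0 := by
      rcases mul_eq_zero.1 d' with h | h
      · simpa [q0, h] using cc
      · exact h
    exact ⟨q' / q, by simp [q0, hr']⟩

end ThreeByThree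

/-! ### Four-dimensional real representations of `so(3)` -/

open scoped ComplexConjugate Matrix

/-- A triple with `f = -ē` comes from a real representation of `so(3)`. If it acts on a
four-dimensional space with weights of both parities, these are `1, 0, 0, -1`. A vector `v` of
weight one is then unique up to a factor, so that `e v̄ = c v` and `f v = -c̄ v̄`, whence
`v = h v = e (f v) = -|c|² v`. -/
theorem IsSl2Triple.eq_zero_of_weight_one_of_conj {h e f : Matrix (Fin 4) (Fin 4) ℂ}
    (t : IsSl2Triple h e f) (hf : f = -e.map conj) {u : Matrix (Fin 4) (Fin 4) ℂ}
    (hu : h * u - u * h = (1 : ℂ) • u) : u = 0 := by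
  by_contra u0
  have t' := t.map_algEquiv (Matrix.toLinAlgEquiv' (R := ℂ) (n := Fin 4))
  have hu' := map_commutator (Matrix.toLinAlgEquiv' (R := ℂ) (n := Fin 4)) hu
  rw [map_smul] at hu'
  obtain ⟨μ, h1, h2⟩ := exists_hasEigenvalue_add hu'
    ((map_ne_zero_iff _ (Matrix.toLinAlgEquiv' (R := ℂ) (n := Fin 4)).injective).2 u0)
  obtain ⟨z, rfl, hz⟩ := t'.exists_int_weight h1
  obtain ⟨z', h', hz'⟩ := t'.exists_int_weight h2
  obtain rfl : z' = z + 1 := by exact_mod_cast h'.symm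
  have H : ∀ w : ℤ, (w.natAbs ≤ z.natAbs ∧ 2 ∣ z - w) ∨
      (w.natAbs ≤ (z + 1).natAbs ∧ 2 ∣ z + 1 - w) →
      End.HasEigenvalue (Matrix.toLinAlgEquiv' h) (w : ℂ) := by
    rintro w (hw | hw)
    · exact hz w hw.1 hw.2
    · exact hz' w hw.1 hw.2
  have m1 := hasEigenvalue_iff_mem_roots.1 (H 1 (by omega))
  have m2 := hasEigenvalue_iff_mem_roots.1 (H (-1) (by omega))
  have m0 := hasEigenvalue_iff_mem_roots.1 (H 0 (by omega))
  -- the four roots are `1`, `-1`, `0` and, the trace being zero, `0`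
  have hcount : h.charpoly.roots.count 1 = 1 := by
    have htr := t.sum_roots_charpoly
    have hcard := card_roots_charpoly h
    obtain ⟨s, hs⟩ := Multiset.exists_cons_of_mem m1
    rw [hs] at m2 m0 htr hcard ⊢
    have m2' := (Multiset.mem_cons.1 m2).resolve_left (by norm_num)
    obtain ⟨s', rfl⟩ := Multiset.exists_cons_of_mem m2'
    have m0' := (Multiset.mem_cons.1 ((Multiset.mem_cons.1 m0).resolve_left
      (by norm_num))).resolve_left (by norm_num)
    obtain ⟨s'', rfl⟩ := Multiset.exists_cons_of_mem m0'
    simp only [Multiset.card_cons, Multiset.sum_cons] at hcard htr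
    obtain ⟨a, rfl⟩ := Multiset.card_eq_one.1 (show s''.card = 1 by omega)
    simp at htr
    subst htr
    norm_num [Multiset.count_cons, Multiset.count_singleton]
  have hdim : finrank ℂ (End.eigenspace (Matrix.toLinAlgEquiv' h) (1 : ℂ)) ≤ 1 := by
    have h1 : finrank ℂ (End.maxGenEigenspace (Matrix.toLin' h) (1 : ℂ)) = 1 := by
      rw [LinearMap.finrank_maxGenEigenspace_eq, Matrix.charpoly_toLin',
        ← Polynomial.count_roots, hcount]
    rw [← h1]
    exact Submodule.finrank_mono (End.eigenspace_le_maxGenEigenspace)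
  have h1' : End.HasEigenvalue (Matrix.toLinAlgEquiv' h) (1 : ℂ) := by simpa using H 1 (by omega)
  obtain ⟨v, hv⟩ := h1'.exists_hasEigenvector
  have hv1 : h *ᵥ v = v := by simpa using hv.apply_eq_smul
  have huniq : ∀ w, h *ᵥ w = w → ∃ c : ℂ, w = c • v := by
    intro w hw
    have hw' : w ∈ End.eigenspace (Matrix.toLinAlgEquiv' h) (1 : ℂ) := by
      rw [End.mem_eigenspace_iff]; simpa using hw
    obtain ⟨c, hc⟩ := (finrank_eq_one_iff_of_nonzero' (⟨v, hv.1⟩ : End.eigenspace _ (1 : ℂ))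
      (by simpa using hv.2)).1 (le_antisymm hdim (by
        rw [Nat.one_le_iff_ne_zero]
        intro h0
        rw [Submodule.finrank_eq_zero] at h0
        exact h1' h0)) ⟨w, hw'⟩
    exact ⟨c, (congrArg Subtype.val hc).symm⟩
  have hconj : ∀ (A : Matrix (Fin 4) (Fin 4) ℂ) (w : Fin 4 → ℂ),
      A.map conj *ᵥ (conj ∘ w) = conj ∘ (A *ᵥ w) := by
    intro A w
    funext i
    exact (RingHom.map_mulVec (starRingEnd ℂ) A w i).symm
  have hcc : ∀ w : Fin 4 → ℂ, conj ∘ conj ∘ w = w := by intro w; funext i; simp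
  have hef : e * f - f * e = h := by rw [← LieRing.of_associative_ring_bracket]; exact t.lie_e_f
  have hf' : f.map conj = -e := by
    rw [hf]; ext i j; simp
  have he' : e.map conj = -f := by rw [hf, neg_neg]
  have hh : h.map conj = -h := by
    rw [← hef, Matrix.map_sub _ (map_sub _), Matrix.map_mul, Matrix.map_mul, he', hf']
    simp
  set w := conj ∘ v with hw
  have hw1 : h *ᵥ w = -w := by
    have := hconj h v
    rw [hh, hv1, Matrix.neg_mulVec] at this
    exact neg_eq_iff_eq_neg.1 this
  have hhe := t.commutator_h_e (R := ℂ)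
  have hraise : ∀ y, h *ᵥ (e *ᵥ y) = e *ᵥ (h *ᵥ y) + (2 : ℂ) • (e *ᵥ y) := by
    intro y
    have := congrArg (· *ᵥ y) hhe
    simp only [Matrix.sub_mulVec, Matrix.smul_mulVec, ← Matrix.mulVec_mulVec] at this
    rw [← this]; abel
  -- `w` has weight `-1`, so `e w` has weight one
  obtain ⟨c, hc⟩ := huniq (e *ᵥ w) (by
    rw [hraise, hw1, Matrix.mulVec_neg, two_smul]; abel)
  have hfv : f *ᵥ v = -(conj c • w) := by
    have := hconj e w
    rw [hw, hcc, ← hw, he', hc, Matrix.neg_mulVec] at this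
    rw [← neg_eq_iff_eq_neg, this]
    funext i
    simp [hw]
  -- otherwise `3` is a weight, and with `0, ±1, -3` there are five
  have hev : e *ᵥ v = 0 := by
    by_contra hev
    have h3 : h *ᵥ (e *ᵥ v) = (3 : ℂ) • (e *ᵥ v) := by
      rw [hraise, hv1, ← one_smul ℂ (e *ᵥ v), smul_smul, ← add_smul]; norm_num
    have h3' : End.HasEigenvalue (Matrix.toLinAlgEquiv' h) (3 : ℂ) :=
      End.hasEigenvalue_of_hasEigenvector (x := e *ᵥ v)
        ⟨by rw [End.mem_eigenspace_iff]; simpa using h3, hev⟩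
    obtain ⟨y, hy, H3⟩ := t'.exists_int_weight h3'
    obtain rfl : y = 3 := by exact_mod_cast hy.symm
    have := card_le_finrank_of_hasEigenvalue_int (h := Matrix.toLinAlgEquiv' h)
      {-3, -1, 0, 1, 3} (fun x hx => by
        simp only [Finset.mem_insert, Finset.mem_singleton] at hx
        by_cases hx0 : x = 0
        · exact H x (by omega)
        · exact H3 x (by omega) (by omega))
    simp at this
  have key : -(conj c * c) • v = v := by
    have := congrArg (· *ᵥ v) hef
    simp only [Matrix.sub_mulVec, ← Matrix.mulVec_mulVec, hev, hfv, hv1, Matrix.mulVec_neg,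
      Matrix.mulVec_smul, hc, Matrix.mulVec_zero, sub_zero, smul_smul] at this
    rw [neg_smul, this]
  have key2 : (-(conj c * c) - 1) • v = 0 := by rw [sub_smul, key, one_smul, sub_self]
  have key3 := (smul_eq_zero.1 key2).resolve_right hv.2
  rw [mul_comm, Complex.mul_conj] at key3
  have key4 := congrArg Complex.re key3
  simp at key4
  linarith [Complex.normSq_nonneg c]

/-! ### Passage to complex matrices -/

section Complexification

variable {L : Type*} [LieRing L] [LieAlgebra ℝ L] {n : ℕ}

/-- The matrices of a real representation, regarded as complex matrices. -/
noncomputable def complexRep (φ : L →ₗ⁅ℝ⁆ Matrix (Fin n) (Fin n) ℝ) :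
    L →ₗ⁅ℝ⁆ Matrix (Fin n) (Fin n) ℂ :=
  (AlgHom.toLieHom (Complex.ofRealAm.mapMatrix (m := Fin n))).comp φ

theorem complexRep_apply (φ : L →ₗ⁅ℝ⁆ Matrix (Fin n) (Fin n) ℝ) (x : L) (i j : Fin n) :
    complexRep φ x i j = (φ x i j : ℂ) := rfl

theorem complexRep_commutator (φ : L →ₗ⁅ℝ⁆ Matrix (Fin n) (Fin n) ℝ) {x y z : L}
    (h : ⁅x, y⁆ = z) :
    complexRep φ x * complexRep φ y - complexRep φ y * complexRep φ x = complexRep φ z := by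
  rw [← h, LieHom.map_lie, LieRing.of_associative_ring_bracket]

/-- A faithful real representation stays injective on the complexification. -/
theorem eq_zero_of_complexRep {φ : L →ₗ⁅ℝ⁆ Matrix (Fin n) (Fin n) ℝ} (hφ : Function.Injective φ)
    {x y : L} (h : complexRep φ x + Complex.I • complexRep φ y = 0) : x = 0 ∧ y = 0 := by
  have h' : ∀ i j, (φ x i j : ℂ) + Complex.I * φ y i j = 0 := fun i j => by
    have := congrFun (congrFun h i) j
    simpa [complexRep_apply] using this
  constructor <;> apply hφ <;> rw [map_zero] <;> ext i j
  · simpa using congrArg Complex.re (h' i j)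
  · simpa using congrArg Complex.im (h' i j)

theorem complexRep_injective {φ : L →ₗ⁅ℝ⁆ Matrix (Fin n) (Fin n) ℝ}
    (hφ : Function.Injective φ) : Function.Injective (complexRep φ) := by
  intro x y hxy
  have := (eq_zero_of_complexRep hφ (x := x - y) (y := 0) (by simp [hxy])).1
  exact sub_eq_zero.1 this

theorem eq_smul_of_complexRep {φ : L →ₗ⁅ℝ⁆ Matrix (Fin n) (Fin n) ℝ}
    (hφ : Function.Injective φ) {x y : L} {c : ℂ} (h : complexRep φ x = c • complexRep φ y) :
    x = c.re • y := by
  apply hφ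
  ext i j
  have := congrArg Complex.re (congrFun (congrFun h i) j)
  simpa [complexRep_apply] using this

theorem isSl2Triple_complexRep {φ : L →ₗ⁅ℝ⁆ Matrix (Fin n) (Fin n) ℝ}
    (hφ : Function.Injective φ) {h e f : L} (t : IsSl2Triple h e f) :
    IsSl2Triple (complexRep φ h) (complexRep φ e) (complexRep φ f) where
  h_ne_zero := (map_ne_zero_iff _ (complexRep_injective hφ)).2 t.h_ne_zero
  lie_e_f := by rw [← LieHom.map_lie, t.lie_e_f]
  lie_h_e_nsmul := by rw [← LieHom.map_lie, t.lie_h_e_nsmul, map_nsmul]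
  lie_h_f_nsmul := by rw [← LieHom.map_lie, t.lie_h_f_nsmul, map_neg, map_nsmul]

/-- A basis `x₁, x₂, x₃` of `so(3)` gives the `sl₂`-triple `2i x₁, x₂ + i x₃, -x₂ + i x₃` of its
complexification. -/
theorem isSl2Triple_complexRep_so3 {φ : L →ₗ⁅ℝ⁆ Matrix (Fin n) (Fin n) ℝ}
    (hφ : Function.Injective φ) {x₁ x₂ x₃ : L} (h0 : x₁ ≠ 0) (h12 : ⁅x₁, x₂⁆ = x₃)
    (h23 : ⁅x₂, x₃⁆ = x₁) (h13 : ⁅x₁, x₃⁆ = -x₂) :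
    IsSl2Triple ((2 * Complex.I) • complexRep φ x₁)
      (complexRep φ x₂ + Complex.I • complexRep φ x₃)
      (-complexRep φ x₂ + Complex.I • complexRep φ x₃) := by
  have c12 := complexRep_commutator φ h12
  have c13 := complexRep_commutator φ h13
  have c23 := complexRep_commutator φ h23
  rw [map_neg] at c13
  have hne := (map_ne_zero_iff _ (complexRep_injective hφ)).2 h0
  generalize complexRep φ x₁ = A at *
  generalize complexRep φ x₂ = B at *
  generalize complexRep φ x₃ = C at *
  have hII := Complex.I_mul_I
  refine ⟨smul_ne_zero (by simp) hne, ?_, ?_, ?_⟩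
  · rw [LieRing.of_associative_ring_bracket, ← c23]
    simp only [add_mul, mul_add, mul_neg, neg_mul, smul_mul_assoc, mul_smul_comm]
    module
  · rw [LieRing.of_associative_ring_bracket]
    have : (2 * Complex.I) • A * (B + Complex.I • C) - (B + Complex.I • C) * (2 * Complex.I) • A =
        (2 * Complex.I) • (A * B - B * A) + (2 * (Complex.I * Complex.I)) • (A * C - C * A) := by
      simp only [add_mul, mul_add, smul_mul_assoc, mul_smul_comm]
      module
    rw [this, c12, c13, hII]
    module
  · rw [LieRing.of_associative_ring_bracket]
    have : (2 * Complex.I) • A * (-B + Complex.I • C) -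
        (-B + Complex.I • C) * (2 * Complex.I) • A =
        -(2 * Complex.I) • (A * B - B * A) + (2 * (Complex.I * Complex.I)) • (A * C - C * A) := by
      simp only [add_mul, mul_add, smul_mul_assoc, mul_smul_comm, mul_neg, neg_mul]
      module
    rw [this, c12, c13, hII]
    module

end Complexification

/-! ### Obstructions to small faithful representations -/

section Obstructions

variable {L : Type*} [LieRing L] [LieAlgebra ℝ L] {h e f : L}

/-- Excludes `gl(3)` for `sl₂` acting on a module `D₁` in the radical, with highest weight
vector `u`. -/
theorem three_notMem_of_weight_two (t : IsSl2Triple h e f) {u : L} (hu : ⁅h, u⁆ = (2 : ℝ) • u)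
    (heu : ⁅e, u⁆ = 0) (hind : ∀ a : ℝ, u ≠ a • e) : 3 ∉ faithfulDims L := by
  rintro ⟨φ, hφ⟩
  have cu := complexRep_commutator φ hu
  have ce := complexRep_commutator φ heu
  rw [map_smul, ← Complex.coe_smul] at cu
  rw [map_zero, sub_eq_zero] at ce
  obtain ⟨c, hc⟩ := (isSl2Triple_complexRep hφ t).eq_smul_of_weight_two
    (by simpa using cu) ce
  exact hind _ (eq_smul_of_complexRep hφ hc)

/-- Excludes `gl(3)` for `so(3)` acting on a module `R₃` in the radical. Over `ℂ` this is the module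
`D₁`, with highest weight vector `y₂ + i y₃`. -/
theorem three_notMem_of_so3_vector {x₁ x₂ x₃ y₁ y₂ y₃ : L} (h0 : x₁ ≠ 0) (h12 : ⁅x₁, x₂⁆ = x₃)
    (h23 : ⁅x₂, x₃⁆ = x₁) (h13 : ⁅x₁, x₃⁆ = -x₂) (k12 : ⁅x₁, y₂⁆ = y₃) (k13 : ⁅x₁, y₃⁆ = -y₂)
    (k22 : ⁅x₂, y₂⁆ = 0) (k23 : ⁅x₂, y₃⁆ = y₁) (k32 : ⁅x₃, y₂⁆ = -y₁) (k33 : ⁅x₃, y₃⁆ = 0)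
    (hind : ∀ a b : ℝ, y₂ ≠ a • x₂ + b • x₃) : 3 ∉ faithfulDims L := by
  rintro ⟨φ, hφ⟩
  have t := isSl2Triple_complexRep_so3 hφ h0 h12 h23 h13
  have c12 := complexRep_commutator φ k12
  have c13 := complexRep_commutator φ k13
  have c22 := complexRep_commutator φ k22
  have c23 := complexRep_commutator φ k23
  have c32 := complexRep_commutator φ k32
  have c33 := complexRep_commutator φ k33
  rw [map_neg] at c13 c32
  rw [map_zero] at c22 c33
  obtain ⟨c, hc⟩ := t.eq_smul_of_weight_two
    (u := complexRep φ y₂ + Complex.I • complexRep φ y₃) (by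
      generalize complexRep φ x₁ = A at *
      generalize complexRep φ y₂ = B at *
      generalize complexRep φ y₃ = C at *
      have : (2 * Complex.I) • A * (B + Complex.I • C) - (B + Complex.I • C) * (2 * Complex.I) • A =
          (2 * Complex.I) • (A * B - B * A) + (2 * (Complex.I * Complex.I)) • (A * C - C * A) := by
        simp only [add_mul, mul_add, smul_mul_assoc, mul_smul_comm]
        module
      rw [this, c12, c13, Complex.I_mul_I]
      module) (by
      rw [← sub_eq_zero]
      generalize complexRep φ x₂ = A at *
      generalize complexRep φ x₃ = A' at *
      generalize complexRep φ y₂ = B at *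
      generalize complexRep φ y₃ = C at *
      have : (A + Complex.I • A') * (B + Complex.I • C) - (B + Complex.I • C) * (A + Complex.I • A')
          = (A * B - B * A) + Complex.I • ((A * C - C * A) + (A' * B - B * A'))
            + (Complex.I * Complex.I) • (A' * C - C * A') := by
        simp only [add_mul, mul_add, smul_mul_assoc, mul_smul_comm]
        module
      rw [this, c22, c23, c32, c33]
      simp)
  apply hind c.re (-c.im)
  apply hφ
  ext i j
  have := congrArg Complex.re (congrFun (congrFun hc i) j)
  simpa [complexRep_apply, sub_eq_add_neg] using this

/-- Excludes `gl(3)` if the radical contains a highest weight vector `x` of a module `D_{1/2}` and a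
commutator `z` that commutes with `h`, `e` and `x`. -/
theorem three_notMem_of_commute (t : IsSl2Triple h e f) {x z a b : L} (hx : ⁅h, x⁆ = x)
    (x0 : x ≠ 0) (hz : ⁅h, z⁆ = 0) (ez : ⁅e, z⁆ = 0) (xz : ⁅x, z⁆ = 0) (hab : ⁅a, b⁆ = z)
    (z0 : z ≠ 0) : 3 ∉ faithfulDims L := by
  rintro ⟨φ, hφ⟩
  have cx := complexRep_commutator φ hx
  have cz := complexRep_commutator φ hz
  have cez := complexRep_commutator φ ez
  have cxz := complexRep_commutator φ xz
  rw [map_zero, sub_eq_zero] at cz cez cxz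
  have inj := complexRep_injective hφ
  exact (map_ne_zero_iff _ inj).2 z0 ((isSl2Triple_complexRep hφ t).eq_zero_of_commute
    (by rw [cx, one_smul]) ((map_ne_zero_iff _ inj).2 x0) cz cez cxz
    (complexRep_commutator φ hab).symm)

/-- Excludes `gl(3)` for an abelian radical `2D_{1/2}` with highest weight vectors `x` and `x'`. -/
theorem three_notMem_of_weight_one (t : IsSl2Triple h e f) {x y x' y' : L} (hx : ⁅h, x⁆ = x)
    (x0 : x ≠ 0) (hx' : ⁅h, x'⁆ = x') (hy : ⁅f, x⁆ = y) (hy' : ⁅f, x'⁆ = y') (xy : ⁅x, y⁆ = 0)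
    (xy' : ⁅x', y'⁆ = 0) (xx' : ⁅x, x'⁆ = 0) (hind : ∀ a : ℝ, x' ≠ a • x) :
    3 ∉ faithfulDims L := by
  rintro ⟨φ, hφ⟩
  have cx := complexRep_commutator φ hx
  have cx' := complexRep_commutator φ hx'
  have cy := complexRep_commutator φ hy
  have cy' := complexRep_commutator φ hy'
  have cxy := complexRep_commutator φ xy
  have cxy' := complexRep_commutator φ xy'
  have cxx' := complexRep_commutator φ xx'
  rw [map_zero, sub_eq_zero] at cxy cxy' cxx'
  obtain ⟨c, hc⟩ := (isSl2Triple_complexRep hφ t).eq_smul_of_weight_one (by rw [cx, one_smul])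
    ((map_ne_zero_iff _ (complexRep_injective hφ)).2 x0) (by rw [cx', one_smul])
    (by rw [cy, cxy]) (by rw [cy', cxy']) cxx'
  exact hind _ (eq_smul_of_complexRep hφ hc)

/-- Excludes `gl(4)` for `sl₂` acting on a module `D_{3/2}` with highest weight vector `u`. -/
theorem four_notMem_of_weight_three (t : IsSl2Triple h e f) {u : L} (hu : ⁅h, u⁆ = (3 : ℝ) • u)
    (u0 : u ≠ 0) : 4 ∉ faithfulDims L := by
  rintro ⟨φ, hφ⟩
  have cu := complexRep_commutator φ hu
  rw [map_smul, ← Complex.coe_smul] at cu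
  let ψ := Matrix.toLinAlgEquiv' (R := ℂ) (n := Fin 4)
  have cu' := map_commutator ψ cu
  rw [map_smul] at cu'
  have := ((isSl2Triple_complexRep hφ t).map_algEquiv ψ).five_le_finrank (by simpa using cu')
    ((map_ne_zero_iff ψ ψ.injective).2 ((map_ne_zero_iff _ (complexRep_injective hφ)).2 u0))
  simp at this

/-- Excludes `gl(4)` for `so(3)` acting on a module `R₄`. The argument uses the real structure: over
`ℂ` the module becomes `2D_{1/2}`, for which `gl(4)` is large enough. -/
theorem four_notMem_of_so3_spinor {x₁ x₂ x₃ y₁ y₂ : L} (h0 : x₁ ≠ 0) (h12 : ⁅x₁, x₂⁆ = x₃)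
    (h23 : ⁅x₂, x₃⁆ = x₁) (h13 : ⁅x₁, x₃⁆ = -x₂) (k1 : ⁅x₁, y₁⁆ = (1 / 2 : ℝ) • y₂)
    (k2 : ⁅x₁, y₂⁆ = -((1 / 2 : ℝ) • y₁)) (y0 : y₁ ≠ 0) : 4 ∉ faithfulDims L := by
  rintro ⟨φ, hφ⟩
  have t := isSl2Triple_complexRep_so3 hφ h0 h12 h23 h13
  have c1 := complexRep_commutator φ k1
  have c2 := complexRep_commutator φ k2
  rw [map_neg, map_smul, ← Complex.coe_smul] at c2
  rw [map_smul, ← Complex.coe_smul] at c1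
  have := t.eq_zero_of_weight_one_of_conj (u := complexRep φ y₁ + Complex.I • complexRep φ y₂) (by
      ext i j; simp [complexRep_apply]; ring) (by
      generalize complexRep φ x₁ = A at *
      generalize complexRep φ y₁ = B at *
      generalize complexRep φ y₂ = C at *
      have : (2 * Complex.I) • A * (B + Complex.I • C) - (B + Complex.I • C) * (2 * Complex.I) • A =
          (2 * Complex.I) • (A * B - B * A) + (2 * (Complex.I * Complex.I)) • (A * C - C * A) := by
        simp only [add_mul, mul_add, smul_mul_assoc, mul_smul_comm]
        module
      rw [this, c1, c2, Complex.I_mul_I]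
      push_cast
      module)
  exact y0 (eq_zero_of_complexRep hφ this).1

end Obstructions

/-! ### Dimensions of faithful representations -/

section Dimension

variable {L : Type*} [LieRing L] [LieAlgebra ℝ L]

theorem finrank_le_sq_of_mem_faithfulDims {n : ℕ} (h : n ∈ faithfulDims L) :
    finrank ℝ L ≤ n * n := by
  obtain ⟨φ, hφ⟩ := h
  have := LinearMap.finrank_le_finrank_of_injective
    (f := (φ : L →ₗ[ℝ] Matrix (Fin n) (Fin n) ℝ)) hφ
  simpa [Module.finrank_matrix] using this

/-- Adding a trivial summand enlarges a faithful representation. -/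
theorem faithfulDims_upward_closed {m n : ℕ} (hmn : m ≤ n) (h : m ∈ faithfulDims L) :
    n ∈ faithfulDims L := by
  obtain ⟨k, rfl⟩ := Nat.exists_eq_add_of_le hmn
  obtain ⟨φ, hφ⟩ := h
  refine ⟨{ toFun := fun x => Matrix.reindexAlgEquiv ℝ ℝ finSumFinEquiv
              (Matrix.fromBlocks (φ x) 0 0 (0 : Matrix (Fin k) (Fin k) ℝ))
            map_add' := fun x y => ?_
            map_smul' := fun c x => ?_
            map_lie' := fun {x y} => ?_ }, fun x y hxy => ?_⟩
  · rw [← map_add, Matrix.fromBlocks_add]; simp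
  · rw [RingHom.id_apply, ← map_smul, Matrix.fromBlocks_smul]; simp
  · rw [LieRing.of_associative_ring_bracket, ← map_mul, ← map_mul, ← map_sub,
      Matrix.fromBlocks_multiply, Matrix.fromBlocks_multiply, sub_eq_add_neg,
      Matrix.fromBlocks_neg, Matrix.fromBlocks_add]
    simp [LieRing.of_associative_ring_bracket, sub_eq_add_neg]
  · have := (Matrix.reindexAlgEquiv ℝ ℝ finSumFinEquiv).injective hxy
    exact hφ (Matrix.fromBlocks_inj.1 this).1

theorem isLeast_faithfulDims {n : ℕ} (h1 : n + 1 ∈ faithfulDims L) (h2 : n ∉ faithfulDims L) :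
    IsLeast (faithfulDims L) (n + 1) := by
  refine ⟨h1, fun m hm => ?_⟩
  by_contra hlt
  exact h2 (faithfulDims_upward_closed (by omega) hm)

end Dimension

/-! ### Brackets of basis vectors and lower bounds -/

section Tables

variable {n : ℕ}

/-- The basis vectors of the algebra of a table. -/
noncomputable def LieTable.X (T : LieTable n) (i : Fin n) : T.Alg := (Pi.single i 1 : Fin n → ℝ)

/-- The coefficient of `X_l` in `[X_i, X_j]`. -/
noncomputable def LieTable.coeff (T : LieTable n) (i j l : Fin n) : ℝ :=
  (T.rel.map fun r => if r.2.2.1 = l then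
      r.2.2.2 * ((if r.1 = i then 1 else 0) * (if r.2.1 = j then 1 else 0) -
        (if r.2.1 = i then 1 else 0) * (if r.1 = j then 1 else 0)) else 0).sum

theorem LieTable.X_apply (T : LieTable n) (i l : Fin n) :
    (T.X i : Fin n → ℝ) l = if l = i then 1 else 0 := Pi.single_apply _ _ _

theorem LieTable.smul_apply (T : LieTable n) (c : ℝ) (x : T.Alg) (l : Fin n) :
    (c • x : T.Alg) l = c * x l := rfl

theorem LieTable.add_apply (T : LieTable n) (x y : T.Alg) (l : Fin n) :
    (x + y : T.Alg) l = x l + y l := rfl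

theorem LieTable.X_ne_zero (T : LieTable n) (i : Fin n) : T.X i ≠ 0 := fun h => by
  have h' : (T.X i : Fin n → ℝ) i = (0 : ℝ) := congrFun h i
  simp [LieTable.X_apply] at h'

theorem LieTable.X_ne_smul (T : LieTable n) {i j : Fin n} (hij : i ≠ j) (a : ℝ) :
    T.X i ≠ a • T.X j := fun h => by
  simpa [LieTable.X_apply, LieTable.smul_apply, hij] using congrFun h i

theorem LieTable.X_ne_smul_add_smul (T : LieTable n) {i j k : Fin n} (hij : i ≠ j) (hik : i ≠ k)
    (a b : ℝ) : T.X i ≠ a • T.X j + b • T.X k := fun h => by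
  simpa [LieTable.X_apply, LieTable.smul_apply, LieTable.add_apply, hij, hik] using congrFun h i

/-- Brackets of basis vectors are read off coefficientwise. -/
theorem LieTable.lie_X_eq_smul (T : LieTable n) {i j k : Fin n} {c : ℝ}
    (h : ∀ l, T.coeff i j l = if l = k then c else 0) : ⁅T.X i, T.X j⁆ = c • T.X k := by
  funext l
  rw [LieTable.smul_apply, LieTable.X_apply, mul_ite, mul_one, mul_zero, ← h l]
  change tableBracket T.rel _ _ l = _
  simp only [tableBracket, LieTable.X_apply, LieTable.coeff]

theorem LieTable.lie_X_eq (T : LieTable n) {i j k : Fin n}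
    (h : ∀ l, T.coeff i j l = if l = k then 1 else 0) : ⁅T.X i, T.X j⁆ = T.X k := by
  rw [T.lie_X_eq_smul h, one_smul]

theorem LieTable.lie_X_eq_neg (T : LieTable n) {i j k : Fin n}
    (h : ∀ l, T.coeff i j l = if l = k then -1 else 0) : ⁅T.X i, T.X j⁆ = -T.X k := by
  rw [T.lie_X_eq_smul h, neg_smul, one_smul]

theorem LieTable.lie_X_eq_zero (T : LieTable n) {i j : Fin n}
    (h : ∀ l, T.coeff i j l = 0) : ⁅T.X i, T.X j⁆ = 0 := by
  rw [T.lie_X_eq_smul (k := i) (c := 0) (by simpa using h), zero_smul]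

theorem LieTable.isSl2Triple (T : LieTable n) {i j k : Fin n}
    (hij : ∀ l, T.coeff i j l = if l = j then 2 else 0)
    (hik : ∀ l, T.coeff i k l = if l = k then -2 else 0)
    (hjk : ∀ l, T.coeff j k l = if l = i then 1 else 0) :
    IsSl2Triple (T.X i) (T.X j) (T.X k) where
  h_ne_zero := T.X_ne_zero i
  lie_e_f := T.lie_X_eq hjk
  lie_h_e_nsmul := by rw [T.lie_X_eq_smul hij, two_smul, two_smul]
  lie_h_f_nsmul := by rw [T.lie_X_eq_smul hik, neg_smul, two_smul, two_smul]

theorem three_notMem_L61 : 3 ∉ faithfulDims L61.Alg := by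
  refine three_notMem_of_so3_vector (x₁ := L61.X 0) (x₂ := L61.X 1) (x₃ := L61.X 2)
    (y₁ := L61.X 3) (y₂ := L61.X 4) (y₃ := L61.X 5) (L61.X_ne_zero 0) (L61.lie_X_eq ?_)
    (L61.lie_X_eq ?_) (L61.lie_X_eq_neg ?_) (L61.lie_X_eq ?_) (L61.lie_X_eq_neg ?_)
    (L61.lie_X_eq_zero ?_) (L61.lie_X_eq ?_) (L61.lie_X_eq_neg ?_) (L61.lie_X_eq_zero ?_)
    (L61.X_ne_smul_add_smul (by decide) (by decide)) <;>
  · intro l; fin_cases l <;> simp [LieTable.coeff, L61]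

theorem three_notMem_L71 : 3 ∉ faithfulDims L71.Alg := by
  refine three_notMem_of_so3_vector (x₁ := L71.X 0) (x₂ := L71.X 1) (x₃ := L71.X 2)
    (y₁ := L71.X 3) (y₂ := L71.X 4) (y₃ := L71.X 5) (L71.X_ne_zero 0) (L71.lie_X_eq ?_)
    (L71.lie_X_eq ?_) (L71.lie_X_eq_neg ?_) (L71.lie_X_eq ?_) (L71.lie_X_eq_neg ?_)
    (L71.lie_X_eq_zero ?_) (L71.lie_X_eq ?_) (L71.lie_X_eq_neg ?_) (L71.lie_X_eq_zero ?_)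
    (L71.X_ne_smul_add_smul (by decide) (by decide)) <;>
  · intro l; fin_cases l <;> simp [LieTable.coeff, L71]

theorem three_notMem_L64 : 3 ∉ faithfulDims L64.Alg := by
  refine three_notMem_of_weight_two (L64.isSl2Triple (i := 0) (j := 1) (k := 2) ?_ ?_ ?_)
    (u := L64.X 3) (L64.lie_X_eq_smul ?_) (L64.lie_X_eq_zero ?_) (L64.X_ne_smul (by decide)) <;>
  · intro l; fin_cases l <;> simp [LieTable.coeff, L64]

theorem three_notMem_L75 : 3 ∉ faithfulDims L75.Alg := by
  refine three_notMem_of_weight_two (L75.isSl2Triple (i := 0) (j := 1) (k := 2) ?_ ?_ ?_)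
    (u := L75.X 3) (L75.lie_X_eq_smul ?_) (L75.lie_X_eq_zero ?_) (L75.X_ne_smul (by decide)) <;>
  · intro l; fin_cases l <;> simp [LieTable.coeff, L75]

theorem three_notMem_L62 : 3 ∉ faithfulDims L62.Alg := by
  refine three_notMem_of_commute (L62.isSl2Triple (i := 0) (j := 1) (k := 2) ?_ ?_ ?_)
    (x := L62.X 3) (z := L62.X 5) (a := L62.X 3) (b := L62.X 4) (L62.lie_X_eq ?_)
    (L62.X_ne_zero 3) (L62.lie_X_eq_zero ?_) (L62.lie_X_eq_zero ?_) (L62.lie_X_eq_zero ?_)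
    (L62.lie_X_eq ?_) (L62.X_ne_zero 5) <;>
  · intro l; fin_cases l <;> simp [LieTable.coeff, L62]

theorem three_notMem_L74 : 3 ∉ faithfulDims L74.Alg := by
  refine three_notMem_of_commute (L74.isSl2Triple (i := 0) (j := 1) (k := 2) ?_ ?_ ?_)
    (x := L74.X 3) (z := L74.X 5) (a := L74.X 3) (b := L74.X 4) (L74.lie_X_eq ?_)
    (L74.X_ne_zero 3) (L74.lie_X_eq_zero ?_) (L74.lie_X_eq_zero ?_) (L74.lie_X_eq_zero ?_)
    (L74.lie_X_eq ?_) (L74.X_ne_zero 5) <;>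
  · intro l; fin_cases l <;> simp [LieTable.coeff, L74]

theorem three_notMem_L73 {p : ℝ} (hp : p ≠ 0) : 3 ∉ faithfulDims (L73 p).Alg := by
  -- for `p ≠ 0` the central vector `X₅` of the nilradical is a commutator
  have h56 : ⁅(L73 p).X 5, (L73 p).X 6⁆ = p • (L73 p).X 5 := by
    apply LieTable.lie_X_eq_smul
    intro l; fin_cases l <;> simp [LieTable.coeff, L73]
  refine three_notMem_of_commute ((L73 p).isSl2Triple (i := 0) (j := 1) (k := 2) ?_ ?_ ?_)
    (x := (L73 p).X 3) (z := (L73 p).X 5) (a := p⁻¹ • (L73 p).X 5) (b := (L73 p).X 6)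
    ((L73 p).lie_X_eq ?_) ((L73 p).X_ne_zero 3) ((L73 p).lie_X_eq_zero ?_)
    ((L73 p).lie_X_eq_zero ?_) ((L73 p).lie_X_eq_zero ?_)
    (by rw [smul_lie, h56, inv_smul_smul₀ hp]) ((L73 p).X_ne_zero 5) <;>
  · intro l; fin_cases l <;> simp [LieTable.coeff, L73]

theorem three_notMem_L77 : 3 ∉ faithfulDims L77.Alg := by
  refine three_notMem_of_weight_one (L77.isSl2Triple (i := 0) (j := 1) (k := 2) ?_ ?_ ?_)
    (x := L77.X 3) (y := L77.X 4) (x' := L77.X 5) (y' := L77.X 6) (L77.lie_X_eq ?_)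
    (L77.X_ne_zero 3) (L77.lie_X_eq ?_) (L77.lie_X_eq ?_) (L77.lie_X_eq ?_)
    (L77.lie_X_eq_zero ?_) (L77.lie_X_eq_zero ?_) (L77.lie_X_eq_zero ?_)
    (L77.X_ne_smul (by decide)) <;>
  · intro l; fin_cases l <;> simp [LieTable.coeff, L77]

theorem four_notMem_L76 : 4 ∉ faithfulDims L76.Alg := by
  refine four_notMem_of_weight_three (L76.isSl2Triple (i := 0) (j := 1) (k := 2) ?_ ?_ ?_)
    (u := L76.X 3) (L76.lie_X_eq_smul ?_) (L76.X_ne_zero 3) <;>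
  · intro l; fin_cases l <;> simp [LieTable.coeff, L76]

theorem four_notMem_L72 : 4 ∉ faithfulDims L72.Alg := by
  have h04 : ⁅L72.X 0, L72.X 4⁆ = (-1 / 2 : ℝ) • L72.X 3 := by
    apply LieTable.lie_X_eq_smul
    intro l; fin_cases l <;> simp [LieTable.coeff, L72]
  refine four_notMem_of_so3_spinor (x₁ := L72.X 0) (x₂ := L72.X 1) (x₃ := L72.X 2)
    (y₁ := L72.X 3) (y₂ := L72.X 4) (L72.X_ne_zero 0) (L72.lie_X_eq ?_) (L72.lie_X_eq ?_)
    (L72.lie_X_eq_neg ?_) (L72.lie_X_eq_smul ?_) (by rw [h04, neg_div, neg_smul])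
    (L72.X_ne_zero 3) <;>
  · intro l; fin_cases l <;> simp [LieTable.coeff, L72]

theorem LieTable.finrank_alg (T : LieTable n) : finrank ℝ T.Alg = n :=
  Module.finrank_fin_fun ℝ

theorem two_notMem_faithfulDims (T : LieTable n) (hn : 5 ≤ n) : 2 ∉ faithfulDims T.Alg := by
  intro h
  have := finrank_le_sq_of_mem_faithfulDims h
  rw [T.finrank_alg] at this
  omega

end Tables

/-! ### The explicit representations -/

/-- A linear parametrization `ρ` of a set of matrices by coordinates, compatible with brackets and
injective, exhibits the set as the image of a faithful representation. The bracket is passed as a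
vector `z` with known coordinates, so that these are computed only once. -/
theorem isFaithfulImage_of_coordinates {k n : ℕ} (T : LieTable k)
    (ρ : (Fin k → ℝ) → Matrix (Fin n) (Fin n) ℝ)
    (linear : ∀ (t : ℝ) (x y : Fin k → ℝ), ρ (t • x + y) = t • ρ x + ρ y)
    (lie : ∀ x y z, (∀ i, z i = tableBracket T.rel x y i) → ρ z = ρ x * ρ y - ρ y * ρ x)
    (inj : ∀ x, (∀ i j, ρ x i j = 0) → ∀ i, x i = 0) {S : Set (Matrix (Fin n) (Fin n) ℝ)}
    (mem : ∀ x, ρ x ∈ S) (surj : ∀ M ∈ S, ∃ x, ρ x = M) :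
    IsFaithfulImage T.Alg S := by
  have add : ∀ x y : Fin k → ℝ, ρ (x + y) = ρ x + ρ y := fun x y => by
    simpa using linear 1 x y
  have zero : ρ 0 = 0 := by simpa using add 0 0
  have smul : ∀ (t : ℝ) (x : Fin k → ℝ), ρ (t • x) = t • ρ x := fun t x => by
    simpa [zero] using linear t x 0
  let ρ' : T.Alg →ₗ[ℝ] Matrix (Fin n) (Fin n) ℝ :=
    { toFun := ρ, map_add' := add, map_smul' := smul }
  refine ⟨{ ρ' with
      map_lie' := fun {x y} => (lie x y _ fun _ => rfl).trans
        (LieRing.of_associative_ring_bracket _ _).symm },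
    (injective_iff_map_eq_zero ρ').2 fun x hx => funext (inj x fun i j => ?_), ?_⟩
  · exact congrFun (congrFun hx i) j
  · ext M
    exact ⟨fun ⟨x, hx⟩ => hx ▸ mem x, fun hM => surj M hM⟩

theorem isFaithfulImage_L51_vector :
    IsFaithfulImage L51.Alg {M | ∃ a b c d e : ℝ, M =
      !![a, b, d;
         c, -a, e;
         0, 0, 0]} := by
  refine isFaithfulImage_of_coordinates L51 (fun x =>
    !![x 0, x 1, x 3;
       x 2, -x 0, x 4;
       0, 0, 0]) (fun t x y => ?_) (fun x y z h => ?_)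
    (fun x h => ?_) (fun x => ⟨_, _, _, _, _, rfl⟩) ?_
  · ext i j
    fin_cases i <;> fin_cases j <;> simp <;> ring
  · simp [Fin.forall_fin_succ, L51, tableBracket] at h
    ext i j
    simp only [Matrix.sub_apply, Matrix.mul_apply, Fin.sum_univ_three]
    fin_cases i <;> fin_cases j <;> simp [h] <;> ring
  · simp [Fin.forall_fin_succ] at h
    simp [Fin.forall_fin_succ]
    grind
  · rintro M ⟨a, b, c, d, e, rfl⟩
    refine ⟨![a, b, c, d, e], ?_⟩
    ext i j
    fin_cases i <;> fin_cases j <;> simp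

theorem isFaithfulImage_L61_affine :
    IsFaithfulImage L61.Alg {M | ∃ a b c d e f : ℝ, M =
      !![0, c, -b, d;
         -c, 0, a, e;
         b, -a, 0, f;
         0, 0, 0, 0]} := by
  refine isFaithfulImage_of_coordinates L61 (fun x =>
    !![0, -x 2, x 1, x 3;
       x 2, 0, -x 0, x 4;
       -x 1, x 0, 0, x 5;
       0, 0, 0, 0]) (fun t x y => ?_) (fun x y z h => ?_)
    (fun x h => ?_) (fun x => ⟨-x 0, -x 1, -x 2, x 3, x 4, x 5, by simp⟩) ?_
  · ext i j
    fin_cases i <;> fin_cases j <;> simp <;> ring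
  · simp [Fin.forall_fin_succ, L61, tableBracket] at h
    ext i j
    simp only [Matrix.sub_apply, Matrix.mul_apply, Fin.sum_univ_four]
    fin_cases i <;> fin_cases j <;> simp [h] <;> ring
  · simp [Fin.forall_fin_succ] at h
    simp [Fin.forall_fin_succ]
    grind
  · rintro M ⟨a, b, c, d, e, f, rfl⟩
    refine ⟨![-a, -b, -c, d, e, f], ?_⟩
    ext i j
    fin_cases i <;> fin_cases j <;> simp

/-- The matrices of `X₃` and `X₄` have the commutator `-2 E₂₃`, whence the factor in the entry
of `X₅`. -/
theorem isFaithfulImage_L62_symplectic :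
    IsFaithfulImage L62.Alg {M | ∃ a b c d e f : ℝ, M =
      !![a, b, 0, d;
         c, -a, 0, e;
         e, -d, 0, f;
         0, 0, 0, 0]} := by
  refine isFaithfulImage_of_coordinates L62 (fun x =>
    !![x 0, x 1, 0, x 3;
       x 2, -x 0, 0, x 4;
       x 4, -x 3, 0, (-2 * x 5);
       0, 0, 0, 0]) (fun t x y => ?_) (fun x y z h => ?_)
    (fun x h => ?_) (fun x => ⟨_, _, _, _, _, _, rfl⟩) ?_
  · ext i j
    fin_cases i <;> fin_cases j <;> simp <;> ring
  · simp [Fin.forall_fin_succ, L62, tableBracket] at h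
    ext i j
    simp only [Matrix.sub_apply, Matrix.mul_apply, Fin.sum_univ_four]
    fin_cases i <;> fin_cases j <;> simp [h] <;> ring
  · simp [Fin.forall_fin_succ] at h
    simp [Fin.forall_fin_succ]
    grind
  · rintro M ⟨a, b, c, d, e, f, rfl⟩
    refine ⟨![a, b, c, d, e, -f / 2], ?_⟩
    ext i j
    fin_cases i <;> fin_cases j <;> simp <;> ring

/-- The scaling makes the difference of the two scalars in the matrix of `X₅` equal to one. -/
theorem isFaithfulImage_L63_vector (l m : ℝ) (hlm : l ≠ m) :
    IsFaithfulImage L63.Alg {M | ∃ a b c d e f : ℝ, M =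
      !![a + l * f, b, d;
         -c, l * f - a, e;
         0, 0, m * f]} := by
  have h0 : m - l ≠ 0 := sub_ne_zero.2 hlm.symm
  refine isFaithfulImage_of_coordinates L63 (fun x =>
    !![x 0 + l * (x 5 / (m - l)), x 1, x 3;
       x 2, l * (x 5 / (m - l)) - x 0, x 4;
       0, 0, m * (x 5 / (m - l))]) (fun t x y => ?_) (fun x y z h => ?_)
    (fun x h => ?_) (fun x => ⟨x 0, x 1, -x 2, x 3, x 4, x 5 / (m - l), by simp⟩) ?_
  · ext i j
    fin_cases i <;> fin_cases j <;> simp <;> ring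
  · simp [Fin.forall_fin_succ, L63, tableBracket] at h
    ext i j
    simp only [Matrix.sub_apply, Matrix.mul_apply, Fin.sum_univ_three]
    fin_cases i <;> fin_cases j <;> simp [h] <;> field_simp <;> ring
  · simp [Fin.forall_fin_succ] at h
    simp [Fin.forall_fin_succ]
    grind
  · rintro M ⟨a, b, c, d, e, f, rfl⟩
    refine ⟨![a, b, -c, d, e, (m - l) * f], ?_⟩
    ext i j
    fin_cases i <;> fin_cases j <;> simp [mul_div_cancel_left₀ _ h0]

theorem isFaithfulImage_L64_affine :
    IsFaithfulImage L64.Alg {M | ∃ a b c d e f : ℝ, M =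
      !![2 * a, 2 * b, 0, d;
         c, 0, b, e;
         0, 2 * c, -2 * a, f;
         0, 0, 0, 0]} := by
  refine isFaithfulImage_of_coordinates L64 (fun x =>
    !![2 * x 0, 2 * x 1, 0, x 3;
       x 2, 0, x 1, x 4;
       0, 2 * x 2, -2 * x 0, x 5;
       0, 0, 0, 0]) (fun t x y => ?_) (fun x y z h => ?_)
    (fun x h => ?_) (fun x => ⟨_, _, _, _, _, _, rfl⟩) ?_
  · ext i j
    fin_cases i <;> fin_cases j <;> simp <;> ring
  · simp [Fin.forall_fin_succ, L64, tableBracket] at h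
    ext i j
    simp only [Matrix.sub_apply, Matrix.mul_apply, Fin.sum_univ_four]
    fin_cases i <;> fin_cases j <;> simp [h] <;> ring
  · simp [Fin.forall_fin_succ] at h
    simp [Fin.forall_fin_succ]
    grind
  · rintro M ⟨a, b, c, d, e, f, rfl⟩
    refine ⟨![a, b, c, d, e, f], ?_⟩
    ext i j
    fin_cases i <;> fin_cases j <;> simp

/-- The radical `D₁` is `sl₂` with zero bracket, placed above the diagonal: `X₃, X₄, X₅` correspond
to `e, -h, -f`. -/
theorem isFaithfulImage_L64_adjoint :
    IsFaithfulImage L64.Alg {M | ∃ a b c d e f : ℝ, M =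
      !![a, b, d, e;
         c, -a, f, -d;
         0, 0, a, b;
         0, 0, c, -a]} := by
  refine isFaithfulImage_of_coordinates L64 (fun x =>
    !![x 0, x 1, -x 4, x 3;
       x 2, -x 0, -x 5, x 4;
       0, 0, x 0, x 1;
       0, 0, x 2, -x 0]) (fun t x y => ?_) (fun x y z h => ?_)
    (fun x h => ?_) (fun x => ⟨x 0, x 1, x 2, -x 4, x 3, -x 5, by simp⟩) ?_
  · ext i j
    fin_cases i <;> fin_cases j <;> simp <;> ring
  · simp [Fin.forall_fin_succ, L64, tableBracket] at h
    ext i j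
    simp only [Matrix.sub_apply, Matrix.mul_apply, Fin.sum_univ_four]
    fin_cases i <;> fin_cases j <;> simp [h] <;> ring
  · simp [Fin.forall_fin_succ] at h
    simp [Fin.forall_fin_succ]
    grind
  · rintro M ⟨a, b, c, d, e, f, rfl⟩
    refine ⟨![a, b, c, e, -d, -f], ?_⟩
    ext i j
    fin_cases i <;> fin_cases j <;> simp

theorem isFaithfulImage_L71_affine (l m : ℝ) (hlm : l ≠ m) :
    IsFaithfulImage L71.Alg {M | ∃ a b c d e f g : ℝ, M =
      !![l * g, c, -b, d;
         -c, l * g, a, e;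
         b, -a, l * g, f;
         0, 0, 0, m * g]} := by
  have h0 : m - l ≠ 0 := sub_ne_zero.2 hlm.symm
  refine isFaithfulImage_of_coordinates L71 (fun x =>
    !![l * (x 6 / (m - l)), -x 2, x 1, x 3;
       x 2, l * (x 6 / (m - l)), -x 0, x 4;
       -x 1, x 0, l * (x 6 / (m - l)), x 5;
       0, 0, 0, m * (x 6 / (m - l))]) (fun t x y => ?_) (fun x y z h => ?_)
    (fun x h => ?_) (fun x => ⟨-x 0, -x 1, -x 2, x 3, x 4, x 5, x 6 / (m - l), by simp⟩) ?_
  · ext i j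
    fin_cases i <;> fin_cases j <;> simp <;> ring
  · simp [Fin.forall_fin_succ, L71, tableBracket] at h
    ext i j
    simp only [Matrix.sub_apply, Matrix.mul_apply, Fin.sum_univ_four]
    fin_cases i <;> fin_cases j <;> simp [h] <;> field_simp <;> ring
  · simp [Fin.forall_fin_succ] at h
    simp [Fin.forall_fin_succ]
    grind
  · rintro M ⟨a, b, c, d, e, f, g, rfl⟩
    refine ⟨![-a, -b, -c, d, e, f, (m - l) * g], ?_⟩
    ext i j
    fin_cases i <;> fin_cases j <;> simp [mul_div_cancel_left₀ _ h0]

theorem isFaithfulImage_L72_quaternion :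
    IsFaithfulImage L72.Alg {M | ∃ a b c d e f g : ℝ, M =
      !![0, -a, -b, -c, d;
         a, 0, -c, b, e;
         b, c, 0, -a, f;
         c, -b, a, 0, g;
         0, 0, 0, 0, 0]} := by
  refine isFaithfulImage_of_coordinates L72 (fun x =>
    !![0, -(x 0 / 2), -(x 1 / 2), -(x 2 / 2), x 3;
       (x 0 / 2), 0, -(x 2 / 2), (x 1 / 2), x 4;
       (x 1 / 2), (x 2 / 2), 0, -(x 0 / 2), x 5;
       (x 2 / 2), -(x 1 / 2), (x 0 / 2), 0, x 6;
       0, 0, 0, 0, 0]) (fun t x y => ?_) (fun x y z h => ?_)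
    (fun x h => ?_) (fun x => ⟨_, _, _, _, _, _, _, rfl⟩) ?_
  · ext i j
    fin_cases i <;> fin_cases j <;> simp <;> ring
  · simp [Fin.forall_fin_succ, L72, tableBracket] at h
    ext i j
    simp only [Matrix.sub_apply, Matrix.mul_apply, Fin.sum_univ_five]
    fin_cases i <;> fin_cases j <;> simp [h] <;> ring
  · simp [Fin.forall_fin_succ] at h
    simp [Fin.forall_fin_succ]
    grind
  · rintro M ⟨a, b, c, d, e, f, g, rfl⟩
    refine ⟨![2 * a, 2 * b, 2 * c, d, e, f, g], ?_⟩
    ext i j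
    fin_cases i <;> fin_cases j <;> simp

theorem isFaithfulImage_L73_affine {l m p : ℝ} (hlm : l ≠ m) (hp : p = 1 / (l - m)) :
    IsFaithfulImage (L73 p).Alg {M | ∃ a b c d e f g : ℝ, M =
      !![a + l * g, b, 0, d;
         c, l * g - a, 0, e;
         0, 0, (m + 1) * g, f;
         0, 0, 0, m * g]} := by
  have h0 : m - l ≠ 0 := sub_ne_zero.2 hlm.symm
  have hp' : p = -1 / (m - l) := by rw [hp, ← neg_sub m l, div_neg, neg_div]
  refine isFaithfulImage_of_coordinates (L73 p) (fun x =>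
    !![x 0 + l * (x 6 / (m - l)), x 1, 0, x 3;
       x 2, l * (x 6 / (m - l)) - x 0, 0, x 4;
       0, 0, (m + 1) * (x 6 / (m - l)), x 5;
       0, 0, 0, m * (x 6 / (m - l))]) (fun t x y => ?_) (fun x y z h => ?_)
    (fun x h => ?_) (fun x => ⟨_, _, _, _, _, _, _, rfl⟩) ?_
  · ext i j
    fin_cases i <;> fin_cases j <;> simp <;> ring
  · simp [Fin.forall_fin_succ, L73, tableBracket] at h
    ext i j
    simp only [Matrix.sub_apply, Matrix.mul_apply, Fin.sum_univ_four]
    fin_cases i <;> fin_cases j <;> simp [h, hp'] <;> field_simp <;> ring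
  · simp [Fin.forall_fin_succ] at h
    simp [Fin.forall_fin_succ]
    grind
  · rintro M ⟨a, b, c, d, e, f, g, rfl⟩
    refine ⟨![a, b, c, d, e, f, (m - l) * g], ?_⟩
    ext i j
    fin_cases i <;> fin_cases j <;> simp [mul_div_cancel_left₀ _ h0]

/-- The last scalar is `2l - m`, so `X₆` is scaled by `l - m` here, not by `m - l`. -/
theorem isFaithfulImage_L74_symplectic (l m : ℝ) (hlm : l ≠ m) :
    IsFaithfulImage L74.Alg {M | ∃ a b c d e f g : ℝ, M =
      !![a + l * g, b, 0, d;
         c, l * g - a, 0, e;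
         -e, d, m * g, f;
         0, 0, 0, (2 * l - m) * g]} := by
  have h0 : l - m ≠ 0 := sub_ne_zero.2 hlm
  refine isFaithfulImage_of_coordinates L74 (fun x =>
    !![x 0 + l * (x 6 / (l - m)), x 1, 0, x 3;
       x 2, l * (x 6 / (l - m)) - x 0, 0, x 4;
       -x 4, x 3, m * (x 6 / (l - m)), (2 * x 5);
       0, 0, 0, (2 * l - m) * (x 6 / (l - m))]) (fun t x y => ?_) (fun x y z h => ?_)
    (fun x h => ?_) (fun x => ⟨_, _, _, _, _, _, _, rfl⟩) ?_
  · ext i j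
    fin_cases i <;> fin_cases j <;> simp <;> ring
  · simp [Fin.forall_fin_succ, L74, tableBracket] at h
    ext i j
    simp only [Matrix.sub_apply, Matrix.mul_apply, Fin.sum_univ_four]
    fin_cases i <;> fin_cases j <;> simp [h] <;> field_simp <;> ring
  · simp [Fin.forall_fin_succ] at h
    simp [Fin.forall_fin_succ]
    grind
  · rintro M ⟨a, b, c, d, e, f, g, rfl⟩
    refine ⟨![a, b, c, d, e, f / 2, (l - m) * g], ?_⟩
    ext i j
    fin_cases i <;> fin_cases j <;> simp [mul_div_cancel_left₀ _ h0] <;> ring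

theorem isFaithfulImage_L75_affine (l m : ℝ) (hlm : l ≠ m) :
    IsFaithfulImage L75.Alg {M | ∃ a b c d e f g : ℝ, M =
      !![2 * a + g * l, 2 * c, 0, f;
         b, g * l, c, e;
         0, 2 * b, g * l - 2 * a, d;
         0, 0, 0, g * m]} := by
  have h0 : m - l ≠ 0 := sub_ne_zero.2 hlm.symm
  refine isFaithfulImage_of_coordinates L75 (fun x =>
    !![2 * x 0 + (x 6 / (m - l)) * l, 2 * x 1, 0, x 3;
       x 2, (x 6 / (m - l)) * l, x 1, x 4;
       0, 2 * x 2, (x 6 / (m - l)) * l - 2 * x 0, x 5;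
       0, 0, 0, (x 6 / (m - l)) * m]) (fun t x y => ?_) (fun x y z h => ?_)
    (fun x h => ?_) (fun x => ⟨_, _, _, _, _, _, _, rfl⟩) ?_
  · ext i j
    fin_cases i <;> fin_cases j <;> simp <;> ring
  · simp [Fin.forall_fin_succ, L75, tableBracket] at h
    ext i j
    simp only [Matrix.sub_apply, Matrix.mul_apply, Fin.sum_univ_four]
    fin_cases i <;> fin_cases j <;> simp [h] <;> field_simp <;> ring
  · simp [Fin.forall_fin_succ] at h
    simp [Fin.forall_fin_succ]
    grind
  · rintro M ⟨a, b, c, d, e, f, g, rfl⟩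
    refine ⟨![a, c, b, f, e, d, (m - l) * g], ?_⟩
    ext i j
    fin_cases i <;> fin_cases j <;> simp [mul_div_cancel_left₀ _ h0]

/-- The radical contains `sl₂` placed above the diagonal: `X₃, X₄, X₅` correspond to `e, -h, -f`. -/
theorem isFaithfulImage_L75_adjoint (l : ℝ) (hl : l ≠ 1) :
    IsFaithfulImage L75.Alg {M | ∃ a b c d e f g : ℝ, M =
      !![a + g, b, -e, d;
         c, g - a, f, e;
         0, 0, a + l * g, b;
         0, 0, c, l * g - a]} := by
  have h0 : l - 1 ≠ 0 := sub_ne_zero.2 hl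
  refine isFaithfulImage_of_coordinates L75 (fun x =>
    !![x 0 + (x 6 / (l - 1)), x 1, -x 4, x 3;
       x 2, (x 6 / (l - 1)) - x 0, -x 5, x 4;
       0, 0, x 0 + l * (x 6 / (l - 1)), x 1;
       0, 0, x 2, l * (x 6 / (l - 1)) - x 0]) (fun t x y => ?_) (fun x y z h => ?_)
    (fun x h => ?_) (fun x => ⟨x 0, x 1, x 2, x 3, x 4, -x 5, x 6 / (l - 1), by simp⟩) ?_
  · ext i j
    fin_cases i <;> fin_cases j <;> simp <;> ring
  · simp [Fin.forall_fin_succ, L75, tableBracket] at h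
    ext i j
    simp only [Matrix.sub_apply, Matrix.mul_apply, Fin.sum_univ_four]
    fin_cases i <;> fin_cases j <;> simp [h] <;> field_simp <;> ring
  · simp [Fin.forall_fin_succ] at h
    simp [Fin.forall_fin_succ]
    grind
  · rintro M ⟨a, b, c, d, e, f, g, rfl⟩
    refine ⟨![a, b, c, d, e, -f, (l - 1) * g], ?_⟩
    ext i j
    fin_cases i <;> fin_cases j <;> simp [mul_div_cancel_left₀ _ h0]

theorem isFaithfulImage_L76_affine :
    IsFaithfulImage L76.Alg {M | ∃ a b c d e f g : ℝ, M =
      !![3 * a, 3 * b, 0, 0, d;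
         c, a, 2 * b, 0, e;
         0, 2 * c, -a, b, f;
         0, 0, 3 * c, -3 * a, g;
         0, 0, 0, 0, 0]} := by
  refine isFaithfulImage_of_coordinates L76 (fun x =>
    !![3 * x 0, 3 * x 1, 0, 0, x 3;
       x 2, x 0, 2 * x 1, 0, x 4;
       0, 2 * x 2, -x 0, x 1, x 5;
       0, 0, 3 * x 2, -3 * x 0, x 6;
       0, 0, 0, 0, 0]) (fun t x y => ?_) (fun x y z h => ?_)
    (fun x h => ?_) (fun x => ⟨_, _, _, _, _, _, _, rfl⟩) ?_
  · ext i j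
    fin_cases i <;> fin_cases j <;> simp <;> ring
  · simp [Fin.forall_fin_succ, L76, tableBracket] at h
    ext i j
    simp only [Matrix.sub_apply, Matrix.mul_apply, Fin.sum_univ_five]
    fin_cases i <;> fin_cases j <;> simp [h] <;> ring
  · simp [Fin.forall_fin_succ] at h
    simp [Fin.forall_fin_succ]
    grind
  · rintro M ⟨a, b, c, d, e, f, g, rfl⟩
    refine ⟨![a, b, c, d, e, f, g], ?_⟩
    ext i j
    fin_cases i <;> fin_cases j <;> simp

theorem isFaithfulImage_L77_two_vectors :
    IsFaithfulImage L77.Alg {M | ∃ a b c d e f g : ℝ, M =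
      !![a, b, d, f;
         c, -a, e, g;
         0, 0, 0, 0;
         0, 0, 0, 0]} := by
  refine isFaithfulImage_of_coordinates L77 (fun x =>
    !![x 0, x 1, x 3, x 5;
       x 2, -x 0, x 4, x 6;
       0, 0, 0, 0;
       0, 0, 0, 0]) (fun t x y => ?_) (fun x y z h => ?_)
    (fun x h => ?_) (fun x => ⟨_, _, _, _, _, _, _, rfl⟩) ?_
  · ext i j
    fin_cases i <;> fin_cases j <;> simp <;> ring
  · simp [Fin.forall_fin_succ, L77, tableBracket] at h
    ext i j
    simp only [Matrix.sub_apply, Matrix.mul_apply, Fin.sum_univ_four]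
    fin_cases i <;> fin_cases j <;> simp [h] <;> ring
  · simp [Fin.forall_fin_succ] at h
    simp [Fin.forall_fin_succ]
    grind
  · rintro M ⟨a, b, c, d, e, f, g, rfl⟩
    refine ⟨![a, b, c, d, e, f, g], ?_⟩
    ext i j
    fin_cases i <;> fin_cases j <;> simp

theorem IsFaithfulImage.mem_faithfulDims {L : Type*} [LieRing L] [LieAlgebra ℝ L] {n : ℕ}
    {S : Set (Matrix (Fin n) (Fin n) ℝ)} (h : IsFaithfulImage L S) : n ∈ faithfulDims L :=
  let ⟨φ, hφ, _⟩ := h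
  ⟨φ, hφ⟩

/-! ### The minimal dimensions -/

theorem mainTheorem5 :
    -- the values of the minimal faithful dimension
    (IsLeast (faithfulDims L51.Alg) 3 ∧
      IsLeast (faithfulDims L61.Alg) 4 ∧
      IsLeast (faithfulDims L62.Alg) 4 ∧
      IsLeast (faithfulDims L63.Alg) 3 ∧
      IsLeast (faithfulDims L64.Alg) 4 ∧
      IsLeast (faithfulDims L71.Alg) 4 ∧
      IsLeast (faithfulDims L72.Alg) 5 ∧
      (∀ p : ℝ, p ≠ 0 → IsLeast (faithfulDims (L73 p).Alg) 4) ∧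
      IsLeast (faithfulDims L74.Alg) 4 ∧
      IsLeast (faithfulDims L75.Alg) 4 ∧
      IsLeast (faithfulDims L76.Alg) 5 ∧
      IsLeast (faithfulDims L77.Alg) 4) ∧
    -- the explicit matrix representations
    IsFaithfulImage L51.Alg {M | ∃ a b c d e : ℝ, M =
      !![a, b, d;
         c, -a, e;
         0, 0, 0]} ∧
    IsFaithfulImage L61.Alg {M | ∃ a b c d e f : ℝ, M =
      !![0, c, -b, d;
         -c, 0, a, e;
         b, -a, 0, f;
         0, 0, 0, 0]} ∧
    IsFaithfulImage L62.Alg {M | ∃ a b c d e f : ℝ, M =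
      !![a, b, 0, d;
         c, -a, 0, e;
         e, -d, 0, f;
         0, 0, 0, 0]} ∧
    (∀ l m : ℝ, l ≠ m → IsFaithfulImage L63.Alg {M | ∃ a b c d e f : ℝ, M =
      !![a + l * f, b, d;
         -c, l * f - a, e;
         0, 0, m * f]}) ∧
    IsFaithfulImage L64.Alg {M | ∃ a b c d e f : ℝ, M =
      !![2 * a, 2 * b, 0, d;
         c, 0, b, e;
         0, 2 * c, -2 * a, f;
         0, 0, 0, 0]} ∧
    IsFaithfulImage L64.Alg {M | ∃ a b c d e f : ℝ, M =
      !![a, b, d, e;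
         c, -a, f, -d;
         0, 0, a, b;
         0, 0, c, -a]} ∧
    (∀ l m : ℝ, l ≠ m → IsFaithfulImage L71.Alg {M | ∃ a b c d e f g : ℝ, M =
      !![l * g, c, -b, d;
         -c, l * g, a, e;
         b, -a, l * g, f;
         0, 0, 0, m * g]}) ∧
    IsFaithfulImage L72.Alg {M | ∃ a b c d e f g : ℝ, M =
      !![0, -a, -b, -c, d;
         a, 0, -c, b, e;
         b, c, 0, -a, f;
         c, -b, a, 0, g;
         0, 0, 0, 0, 0]} ∧
    (∀ l m p : ℝ, l ≠ m → p = 1 / (l - m) →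
      IsFaithfulImage (L73 p).Alg {M | ∃ a b c d e f g : ℝ, M =
      !![a + l * g, b, 0, d;
         c, l * g - a, 0, e;
         0, 0, (m + 1) * g, f;
         0, 0, 0, m * g]}) ∧
    (∀ l m : ℝ, l ≠ m → IsFaithfulImage L74.Alg {M | ∃ a b c d e f g : ℝ, M =
      !![a + l * g, b, 0, d;
         c, l * g - a, 0, e;
         -e, d, m * g, f;
         0, 0, 0, (2 * l - m) * g]}) ∧
    (∀ l m : ℝ, l ≠ m → IsFaithfulImage L75.Alg {M | ∃ a b c d e f g : ℝ, M =
      !![2 * a + g * l, 2 * c, 0, f;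
         b, g * l, c, e;
         0, 2 * b, g * l - 2 * a, d;
         0, 0, 0, g * m]}) ∧
    (∀ l : ℝ, l ≠ 1 → IsFaithfulImage L75.Alg {M | ∃ a b c d e f g : ℝ, M =
      !![a + g, b, -e, d;
         c, g - a, f, e;
         0, 0, a + l * g, b;
         0, 0, c, l * g - a]}) ∧
    IsFaithfulImage L76.Alg {M | ∃ a b c d e f g : ℝ, M =
      !![3 * a, 3 * b, 0, 0, d;
         c, a, 2 * b, 0, e;
         0, 2 * c, -a, b, f;
         0, 0, 3 * c, -3 * a, g;
         0, 0, 0, 0, 0]} ∧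
    IsFaithfulImage L77.Alg {M | ∃ a b c d e f g : ℝ, M =
      !![a, b, d, f;
         c, -a, e, g;
         0, 0, 0, 0;
         0, 0, 0, 0]} := by
  refine ⟨⟨?_, ?_, ?_, ?_, ?_, ?_, ?_, fun p hp => ?_, ?_, ?_, ?_, ?_⟩,
    isFaithfulImage_L51_vector, isFaithfulImage_L61_affine, isFaithfulImage_L62_symplectic,
    isFaithfulImage_L63_vector, isFaithfulImage_L64_affine, isFaithfulImage_L64_adjoint,
    isFaithfulImage_L71_affine, isFaithfulImage_L72_quaternion,
    fun l m p => isFaithfulImage_L73_affine, isFaithfulImage_L74_symplectic,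
    isFaithfulImage_L75_affine, isFaithfulImage_L75_adjoint, isFaithfulImage_L76_affine,
    isFaithfulImage_L77_two_vectors⟩
  · exact isLeast_faithfulDims isFaithfulImage_L51_vector.mem_faithfulDims
      (two_notMem_faithfulDims L51 le_rfl)
  · exact isLeast_faithfulDims isFaithfulImage_L61_affine.mem_faithfulDims three_notMem_L61
  · exact isLeast_faithfulDims isFaithfulImage_L62_symplectic.mem_faithfulDims three_notMem_L62
  · exact isLeast_faithfulDims (isFaithfulImage_L63_vector 0 1 zero_ne_one).mem_faithfulDims
      (two_notMem_faithfulDims L63 (by norm_num))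
  · exact isLeast_faithfulDims isFaithfulImage_L64_affine.mem_faithfulDims three_notMem_L64
  · exact isLeast_faithfulDims (isFaithfulImage_L71_affine 0 1 zero_ne_one).mem_faithfulDims
      three_notMem_L71
  · exact isLeast_faithfulDims isFaithfulImage_L72_quaternion.mem_faithfulDims four_notMem_L72
  · -- the parameters `l = 1 / p` and `m = 0` solve `p = 1 / (l - m)`
    exact isLeast_faithfulDims (isFaithfulImage_L73_affine (l := 1 / p) (m := 0)
      (one_div_ne_zero hp) (by simp)).mem_faithfulDims (three_notMem_L73 hp)
  · exact isLeast_faithfulDims (isFaithfulImage_L74_symplectic 0 1 zero_ne_one).mem_faithfulDims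
      three_notMem_L74
  · exact isLeast_faithfulDims (isFaithfulImage_L75_affine 0 1 zero_ne_one).mem_faithfulDims
      three_notMem_L75
  · exact isLeast_faithfulDims isFaithfulImage_L76_affine.mem_faithfulDims four_notMem_L76
  · exact isLeast_faithfulDims isFaithfulImage_L77_two_vectors.mem_faithfulDims three_notMem_L77
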